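/- **Setting (clustering with a perfect pairwise oracle and side information).** An unknown partition of the vertex set $V=\{1,\dots,n\}$ into $k$ nonempty clusters is to be recovered. A query names two vertices $u,v$ and is answered $+1$ if $u,v$ lie in the same cluster and $-1$ otherwise; queries may be chosen adaptively. Before querying, the algorithm is given $n$ and a symmetric side-information matrix $W=(w_{u,v})$, whose entries $w_{u,v}=w_{v,u}$ for unordered pairs $u\ne v$ are independent, drawn from the pmf $f_+$ if $u,v$ lie in the same cluster and from the pmf $f_-$ otherwise. Here $f_+$ and $f_-$ are pmfs on the same finitely many points $a_1,\dots,a_q\in[0,1]$. Write $D(f\|g)=\sum_i f(a_i)\ln\frac{f(a_i)}{g(a_i)}$ and $\Delta=\Delta(f_+,f_-)=D(f_+\|f_-)+D(f_-\|f_+)$. An algorithm is *Las Vegas* if its output is the true partition for every partition and every side-information matrix. No algorithm below is given $k$. **Theorem.** Let $\epsilon>0$, and consider pmfs $f_+,f_-$ as above with $\min_i f_+(a_i)\ge\epsilon$, $\min_i f_-(a_i)\ge\epsilon$ and $\Delta>0$. The constants $C$ below depend only on $\epsilon$, and the bounds hold for all $n$ and all partitions of $V$ into $k$ clusters. 1.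 (Known $f_+,f_-$, Monte Carlo.) For all such $f_+,f_-$ there is an algorithm that outputs the true partition with probability at least $1-\frac2n$ and always makes at most $C\,\frac{k^2\log n}{\Delta}$ queries. 2. (Known $f_+,f_-$, Las Vegas.) For all such $f_+,f_-$ there is a Las Vegas algorithm whose expected number of queries is at most $C\left(n+\frac{k^2\log n}{\Delta}\right)$. 3. (Unknown $k,f_+,f_-$, Las Vegas.) There is a single Las Vegas algorithm, depending on none of $k$, $f_+$, $f_-$, $\epsilon$ and $a_1,\dots,a_q$, such that for every $\epsilon>0$ there is a $C$ such that for all such $f_+,f_-$ its expected number of queries is at most $C\left(n\log n+\frac{k^2\log n}{\Delta}\right)$. -/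

import Mathlib

open MeasureTheory

/-! ## Clusterings, the perfect oracle, and query algorithms -/

/-- A clustering of the vertex set `Fin n` into disjoint nonempty clusters is an equivalence
relation; `numClusters P` is the number `k` of its clusters. -/
noncomputable def numClusters {n : ℕ} (P : Setoid (Fin n)) : ℕ := Nat.card (Quotient P)

open Classical in
/-- The perfect oracle of the clustering `P`: it answers `true` (that is, `+1`) if `u` and `v` lie in
the same cluster, and `false` (that is, `-1`) otherwise. -/
noncomputable def perfectOracle {n : ℕ} (P : Setoid (Fin n)) (u v : Fin n) : Bool :=
  decide (P u v)

/-- An adaptive strategy of pairwise queries on `n` vertices, as a decision tree: either stop and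
output a clustering, or query a pair of vertices and continue according to the answer. -/
inductive QueryTree (n : ℕ) : Type where
  | output (Q : Setoid (Fin n)) : QueryTree n
  | query (u v : Fin n) (next : Bool → QueryTree n) : QueryTree n

namespace QueryTree

/-- The clustering that the strategy outputs when the queries are answered by `O`. -/
def result {n : ℕ} (O : Fin n → Fin n → Bool) : QueryTree n → Setoid (Fin n)
  | output Q => Q
  | query u v next => (next (O u v)).result O

/-- The number of queries that the strategy makes when the queries are answered by `O`. -/
def cost {n : ℕ} (O : Fin n → Fin n → Bool) : QueryTree n → ℕ
  | output _ => 0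
  | query u v next => (next (O u v)).cost O + 1

end QueryTree

/-! ## Side information -/

/-- Unordered pairs of distinct vertices: the index set of the independent entries `w_{u,v} = w_{v,u}`
of the side information matrix. -/
abbrev VertexPair (n : ℕ) : Type := {e : Sym2 (Fin n) // ¬ e.IsDiag}

/-- The two vertices of the pair `e` lie in the same cluster of `P`. -/
def SameCluster {n : ℕ} (P : Setoid (Fin n)) (e : VertexPair n) : Prop :=
  ∀ u ∈ e.1, ∀ v ∈ e.1, P u v

open Classical in
/-- The law of the side information when the true clustering is `P`: the entries are independent, and
the entry of a pair is drawn from `fp` if the pair lies within a cluster and from `fm` otherwise. -/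
noncomputable def sideInfoLaw {n : ℕ} {S : Finset ℝ} (fp fm : PMF S) (P : Setoid (Fin n)) :
    Measure (VertexPair n → S) :=
  Measure.pi fun e => if SameCluster P e then fp.toMeasure else fm.toMeasure

/-- An algorithm reads the number `n` of vertices and the side information (a real number for each
pair of vertices), and then queries adaptively. Everything else that it may depend on is visible in
the order of quantifiers where it is used. -/
abbrev ClusterAlgorithm : Type := ∀ n : ℕ, (VertexPair n → ℝ) → QueryTree n

namespace ClusterAlgorithm

/-- The output of the algorithm on side information `W` when the true clustering is `P`. -/
noncomputable def result (A : ClusterAlgorithm) {n : ℕ} {S : Finset ℝ} (P : Setoid (Fin n))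
    (W : VertexPair n → S) : Setoid (Fin n) :=
  (A n fun e => (W e : ℝ)).result (perfectOracle P)

/-- The number of queries of the algorithm on side information `W` when the true clustering is `P`. -/
noncomputable def cost (A : ClusterAlgorithm) {n : ℕ} {S : Finset ℝ} (P : Setoid (Fin n))
    (W : VertexPair n → S) : ℕ :=
  (A n fun e => (W e : ℝ)).cost (perfectOracle P)

/-- Probability that the algorithm outputs the true clustering `P`. -/
noncomputable def successProb (A : ClusterAlgorithm) {n : ℕ} {S : Finset ℝ} (fp fm : PMF S)
    (P : Setoid (Fin n)) : ℝ :=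
  (sideInfoLaw fp fm P).real {W | A.result P W = P}

/-- Expected number of queries of the algorithm when the true clustering is `P`. (The sample space is
finite, so there is no question of integrability.) -/
noncomputable def expectedCost (A : ClusterAlgorithm) {n : ℕ} {S : Finset ℝ} (fp fm : PMF S)
    (P : Setoid (Fin n)) : ℝ :=
  ∫ W, (A.cost P W : ℝ) ∂(sideInfoLaw fp fm P)

/-- Las Vegas: whatever the true clustering and the side information are, the output is correct. -/
def IsLasVegas (A : ClusterAlgorithm) : Prop :=
  ∀ (n : ℕ) (W : VertexPair n → ℝ) (P : Setoid (Fin n)),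
    (A n W).result (perfectOracle P) = P

end ClusterAlgorithm

/-- Symmetric divergence `Δ(f, g) = D(f ‖ g) + D(g ‖ f)` of two pmfs, with natural logarithms. It is
used only for pmfs with full support, for which both divergences are finite. -/
noncomputable def symmDivergence {S : Finset ℝ} (f g : PMF S) : ℝ :=
  (InformationTheory.klDiv f.toMeasure g.toMeasure).toReal +
    (InformationTheory.klDiv g.toMeasure f.toMeasure).toReal

/-- `fp` and `fm` are pmfs on the same finitely many points of `[0, 1]`, all of their masses are at
least `ε`, and they are not the same pmf (their symmetric divergence is positive). -/
structure AdmissiblePair (ε : ℝ) {S : Finset ℝ} (fp fm : PMF S) : Prop where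
  subset_unit : (S : Set ℝ) ⊆ Set.Icc 0 1
  le_fp : ∀ a, ε ≤ (fp a).toReal
  le_fm : ∀ a, ε ≤ (fm a).toReal
  symmDivergence_pos : 0 < symmDivergence fp fm

/-! ## Divergence of pmfs with masses bounded below -/

/-! A single value `a` suffices to tell the two pmfs apart. Since all masses are at least `ε`, each
divergence is bounded by a chi-square sum, hence by the squared `ℓ²` distance divided by `ε`. There
are at most `1 / ε` points, so some `a` satisfies `(f₊(a) - f₋(a))² ≥ ε² Δ / 2` (`exists_sq_le`). By
Hoeffding's inequality, about `log n / (ε² Δ)` entries between a vertex `v` and a cluster reveal,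
through the frequency of `a`, whether `v` belongs to it.

The vertices are processed in increasing order. As long as the assignments are correct, the known
part of a cluster when `v` arrives is its set of members before `v`. This set depends on the
partition but not on `W` (`fiberBefore_repsAt`). So adaptivity creates no dependence problem: a
union bound over at most `n²` pairs of a vertex and a cluster gives one event on which every
comparison with at least `M` earlier vertices is reliable.

The Monte Carlo algorithm trusts these comparisons and queries representatives only when no large
known cluster matches. For its worst-case cost, a positive answer pointing to a cluster that already
has `M` vertices exposes an error, and the algorithm gives up. Hence at most `M` queried vertices
are kept per representative. Representatives always lie in distinct true clusters, even after wrong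
assignments, which bounds the queries by `k (M k + 1)` (`cost_trusting_le`).

The Las Vegas algorithms verify every proposal by a query and fall back on all representatives
(`guided_spec`). On the good event the fallback is needed only for the at most `M k` vertices with
fewer than `M` predecessors in their cluster. The bad event has probability `O(1 / n)`, with a
constant depending on `ε`, and costs at most `n²` queries beyond those spent on hints.

With unknown pmfs, the frequency vectors from `v` to large foreign clusters are all close to `f₋`,
while that of its own cluster is not. Among at least three clusters the own one is the unique
outlier (`IsIsolated.eq`); if there are at most two, both are tried. The unknown threshold `M` is
replaced by all powers of two, which costs the factor `log n` in front of `n`. -/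

theorem PMF.sum_toReal_eq_one {α : Type*} [Fintype α] (r : PMF α) : ∑ a, (r a).toReal = 1 := by
  rw [← ENNReal.toReal_sum (fun a _ => r.apply_ne_top a), ← tsum_fintype (L := .unconditional α),
    r.tsum_coe]
  simp

/-- The inequality `log x ≤ x - 1` bounds the divergence by the chi-square sum `∑ (p - q)² / q`,
whose denominators are at least `ε`. -/
theorem toReal_klDiv_le_sum_sq {α : Type*} [Fintype α] [MeasurableSpace α]
    [MeasurableSingletonClass α] (p q : PMF α) {ε : ℝ} (hε : 0 < ε)
    (hp : ∀ a, ε ≤ (p a).toReal) (hq : ∀ a, ε ≤ (q a).toReal) :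
    (InformationTheory.klDiv p.toMeasure q.toMeasure).toReal ≤
      (∑ a, ((p a).toReal - (q a).toReal) ^ 2) / ε := by
  have hac : p.toMeasure ≪ q.toMeasure := by
    intro s hs
    have : s = ∅ := by
      by_contra hne
      obtain ⟨a, ha⟩ := Set.nonempty_iff_ne_empty.mpr hne
      have h0 : q.toMeasure {a} = 0 :=
        measure_mono_null (Set.singleton_subset_iff.mpr ha) hs
      rw [PMF.toMeasure_apply_singleton _ _ (measurableSet_singleton a)] at h0
      have := hq a
      rw [h0] at this
      simp at this
      linarith
    simp [this]
  rw [InformationTheory.toReal_klDiv_of_measure_eq hac (by simp), PMF.integral_eq_sum]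
  have hrn : ∀ a, llr p.toMeasure q.toMeasure a ≤ (p a).toReal / (q a).toReal - 1 := by
    intro a
    have h := Measure.setLIntegral_rnDeriv hac {a}
    rw [lintegral_singleton, PMF.toMeasure_apply_singleton _ _ (measurableSet_singleton a),
      PMF.toMeasure_apply_singleton _ _ (measurableSet_singleton a)] at h
    have h2 : (p.toMeasure.rnDeriv q.toMeasure a).toReal * (q a).toReal = (p a).toReal := by
      rw [← ENNReal.toReal_mul, h]
    have hqa : 0 < (q a).toReal := hε.trans_le (hq a)
    have hpa : 0 < (p a).toReal := hε.trans_le (hp a)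
    have h3 : (p.toMeasure.rnDeriv q.toMeasure a).toReal = (p a).toReal / (q a).toReal := by
      rw [← h2]; field_simp
    rw [llr, h3]
    exact Real.log_le_sub_one_of_pos (by positivity)
  -- Subtracting `p a - q a` does not change the sum, because both masses total one, and it turns
  -- each summand into `(p - q)² / q`.
  calc ∑ a, (p a).toReal • llr p.toMeasure q.toMeasure a
      ≤ ∑ a, ((p a).toReal * ((p a).toReal / (q a).toReal - 1)
          - ((p a).toReal - (q a).toReal)) := by
        rw [Finset.sum_sub_distrib (f := fun a => (p a).toReal * ((p a).toReal / (q a).toReal - 1)),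
          Finset.sum_sub_distrib (f := fun a => (p a).toReal), p.sum_toReal_eq_one,
          q.sum_toReal_eq_one]
        simp only [sub_self, sub_zero, smul_eq_mul]
        exact Finset.sum_le_sum fun a _ =>
          mul_le_mul_of_nonneg_left (hrn a) ENNReal.toReal_nonneg
    _ ≤ ∑ a, ((p a).toReal - (q a).toReal) ^ 2 / ε := by
        refine Finset.sum_le_sum fun a _ => ?_
        have hqa : 0 < (q a).toReal := hε.trans_le (hq a)
        have : (p a).toReal * ((p a).toReal / (q a).toReal - 1) - ((p a).toReal - (q a).toReal)
            = ((p a).toReal - (q a).toReal) ^ 2 / (q a).toReal := by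
          field_simp
        rw [this]
        exact div_le_div_of_nonneg_left (sq_nonneg _) hε (hq a)
    _ = _ := by rw [Finset.sum_div]

theorem PMF.toReal_apply_le_one {α : Type*} (r : PMF α) (a : α) : (r a).toReal ≤ 1 :=
  ENNReal.toReal_le_of_le_ofReal zero_le_one (by simpa using r.coe_le_one a)

namespace AdmissiblePair

variable {ε : ℝ} {S : Finset ℝ} {fp fm : PMF S}

theorem card_mul_le (h : AdmissiblePair ε fp fm) : (S.card : ℝ) * ε ≤ 1 := by
  have := fp.sum_toReal_eq_one
  rw [← this, ← Fintype.card_coe S, ← nsmul_eq_mul, ← Finset.card_univ]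
  exact Finset.card_nsmul_le_sum _ _ _ fun a _ => h.le_fp a

/-- Some point distinguishes the two pmfs, by a margin controlled by the divergence. -/
theorem exists_sq_le (h : AdmissiblePair ε fp fm) (hε : 0 < ε) :
    ∃ a, ε ^ 2 * symmDivergence fp fm / 2 ≤ ((fp a).toReal - (fm a).toReal) ^ 2 := by
  have hne : (Finset.univ : Finset S).Nonempty := by
    obtain ⟨a, -⟩ := fp.support_nonempty
    exact ⟨a, Finset.mem_univ a⟩
  obtain ⟨a, -, ha⟩ := Finset.exists_max_image Finset.univ
    (fun a => ((fp a).toReal - (fm a).toReal) ^ 2) hne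
  refine ⟨a, ?_⟩
  have h1 := toReal_klDiv_le_sum_sq fp fm hε h.le_fp h.le_fm
  have h2 := toReal_klDiv_le_sum_sq fm fp hε h.le_fm h.le_fp
  have hs : ∑ b, ((fm b).toReal - (fp b).toReal) ^ 2 = ∑ b, ((fp b).toReal - (fm b).toReal) ^ 2 :=
    Finset.sum_congr rfl fun b _ => by ring
  rw [hs] at h2
  set x := ((fp a).toReal - (fm a).toReal) ^ 2 with hx
  have hx0 : 0 ≤ x := sq_nonneg _
  have h3 : ∑ b, ((fp b).toReal - (fm b).toReal) ^ 2 ≤ S.card * x := by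
    have := Finset.sum_le_card_nsmul Finset.univ
      (fun b => ((fp b).toReal - (fm b).toReal) ^ 2) x ha
    rwa [Finset.card_univ, Fintype.card_coe, nsmul_eq_mul] at this
  have h4 : symmDivergence fp fm * ε ≤ 2 * (S.card * x) := by
    rw [le_div_iff₀ hε] at h1 h2
    unfold symmDivergence
    linarith
  have h5 : symmDivergence fp fm * ε ^ 2 ≤ 2 * x := by
    calc symmDivergence fp fm * ε ^ 2 = (symmDivergence fp fm * ε) * ε := by ring
      _ ≤ 2 * (S.card * x) * ε := mul_le_mul_of_nonneg_right h4 hε.le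
      _ = 2 * ((S.card * ε) * x) := by ring
      _ ≤ 2 * (1 * x) := by gcongr; exact h.card_mul_le
      _ = 2 * x := by ring
  linarith

/-- Keeps `log n / (ε² Δ)` bounded away from zero for `n ≥ 2`, so that the rounding in the sample
size costs only a constant factor. -/
theorem sq_mul_symmDivergence_le_two (h : AdmissiblePair ε fp fm) (hε : 0 < ε) :
    ε ^ 2 * symmDivergence fp fm ≤ 2 := by
  obtain ⟨a, ha⟩ := h.exists_sq_le hε
  have h1 := fp.toReal_apply_le_one a
  have h2 := fm.toReal_apply_le_one a
  have h3 : 0 ≤ (fp a).toReal := ENNReal.toReal_nonneg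
  have h4 : 0 ≤ (fm a).toReal := ENNReal.toReal_nonneg
  have : ((fp a).toReal - (fm a).toReal) ^ 2 ≤ 1 := by
    rw [sq_le_one_iff_abs_le_one, abs_le]
    constructor <;> linarith
  linarith

end AdmissiblePair

/-! ## Concentration of the empirical frequencies -/

open ProbabilityTheory in
/-- Two-sided Hoeffding bound for the number of coordinates in `s` that take the value `a`, when these
coordinates are identically distributed. -/
theorem measureReal_pi_abs_card_sub_ge_le {ι α : Type*} [Fintype ι] [MeasurableSpace α]
    [MeasurableSingletonClass α] [DecidableEq α] (μ : ι → Measure α)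
    [∀ i, IsProbabilityMeasure (μ i)] (s : Finset ι) (a : α) (p : ℝ)
    (hp : ∀ i ∈ s, (μ i).real {a} = p) {t : ℝ} (ht : 0 ≤ t) :
    (Measure.pi μ).real {W | t * s.card ≤ |((s.filter fun i => W i = a).card : ℝ) - s.card * p|}
      ≤ 2 * Real.exp (-2 * s.card * t ^ 2) := by
  set X : ∀ i : ι, α → ℝ := fun i => ({a} : Set α).indicator 1 with hX
  have hXm : ∀ i, Measurable (X i) := fun i =>
    measurable_const.indicator (measurableSet_singleton a)
  have hmean : ∀ i ∈ s, ∫ W, X i (W i) ∂(Measure.pi μ) = p := by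
    intro i hi
    rw [integral_comp_eval (hXm i).aestronglyMeasurable, hX, integral_indicator_one
      (measurableSet_singleton a), hp i hi]
  -- Hoeffding's lemma: a variable with values in `[0, 1]` has variance proxy `((1 - 0) / 2)² = 1 /
  -- 4`.
  have hsub : ∀ i ∈ s, HasSubgaussianMGF (fun W : ι → α => X i (W i) - p) (1 / 4)
      (Measure.pi μ) := by
    intro i hi
    have h := hasSubgaussianMGF_of_mem_Icc (μ := Measure.pi μ) (X := fun W => X i (W i))
      (a := 0) (b := 1) ((hXm i).comp (measurable_pi_apply i)).aemeasurable
      (Filter.Eventually.of_forall fun W => by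
        by_cases hW : W i = a <;> simp [hX, hW])
    rw [hmean i hi] at h
    convert h using 1
    simp
    norm_num
  have hind : iIndepFun (fun i (W : ι → α) => X i (W i) - p) (Measure.pi μ) :=
    iIndepFun_pi (X := fun i x => X i x - p) fun i => ((hXm i).sub_const p).aemeasurable
  have hind' : iIndepFun (fun i (W : ι → α) => -(X i (W i) - p)) (Measure.pi μ) :=
    iIndepFun_pi (X := fun i x => -(X i x - p)) fun i => ((hXm i).sub_const p).neg.aemeasurable
  have hm : (0 : ℝ) ≤ t * s.card := by positivity
  have h1 := HasSubgaussianMGF.measure_sum_ge_le_of_iIndepFun hind hsub hm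
  have h2 := HasSubgaussianMGF.measure_sum_ge_le_of_iIndepFun hind'
    (fun i hi => (hsub i hi).neg) hm
  have hexp : -(t * s.card) ^ 2 / (2 * ((∑ _i ∈ s, (1 / 4 : NNReal) : NNReal) : ℝ))
      = -2 * s.card * t ^ 2 := by
    rcases s.eq_empty_or_nonempty with rfl | hs
    · simp
    · have : (0 : ℝ) < s.card := by exact_mod_cast hs.card_pos
      rw [Finset.sum_const, nsmul_eq_mul]
      push_cast
      field_simp
      ring
  rw [hexp] at h1 h2
  have hcount : ∀ W : ι → α, ∑ i ∈ s, (X i (W i) - p)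
      = ((s.filter fun i => W i = a).card : ℝ) - s.card * p := by
    intro W
    rw [Finset.sum_sub_distrib, Finset.sum_const, nsmul_eq_mul, Finset.card_filter]
    simp only [hX, Set.indicator_apply, Set.mem_singleton_iff, Pi.one_apply]
    push_cast
    rfl
  calc _ ≤ (Measure.pi μ).real ({W | t * s.card ≤ ∑ i ∈ s, (X i (W i) - p)} ∪
          {W | t * s.card ≤ ∑ i ∈ s, -(X i (W i) - p)}) := by
        refine measureReal_mono fun W hW => ?_
        simp only [Set.mem_union, Set.mem_ofPred_eq, Finset.sum_neg_distrib, hcount] at hW ⊢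
        exact le_abs.mp hW
    _ ≤ _ := measureReal_union_le _ _
    _ ≤ _ := by linarith

/-! ### Frequencies between a vertex and the earlier part of a cluster -/

/-- The entry of the side information matrix at `v`, `u`, with the value `0` on the diagonal. -/
noncomputable def sideEntry {n : ℕ} (W : VertexPair n → ℝ) (v u : Fin n) : ℝ :=
  if h : (s(v, u)).IsDiag then 0 else W ⟨s(v, u), h⟩

/-- The fraction of the vertices `u ∈ T` whose entry at `v`, `u` is `x`. -/
noncomputable def valueFreq {n : ℕ} (W : VertexPair n → ℝ) (v : Fin n) (T : Finset (Fin n))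
    (x : ℝ) : ℝ :=
  ((T.filter fun u => sideEntry W v u = x).card : ℝ) / T.card

open Classical in
/-- The vertices before `v` that lie in the cluster of `c`. -/
noncomputable def earlierIn {n : ℕ} (P : Setoid (Fin n)) (v c : Fin n) : Finset (Fin n) :=
  Finset.univ.filter fun u => u < v ∧ P u c

theorem mem_earlierIn {n : ℕ} {P : Setoid (Fin n)} {v c u : Fin n} :
    u ∈ earlierIn P v c ↔ u < v ∧ P u c := by
  simp [earlierIn]

instance {n : ℕ} {S : Finset ℝ} (fp fm : PMF S) (P : Setoid (Fin n)) :
    IsProbabilityMeasure (sideInfoLaw fp fm P) := by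
  unfold sideInfoLaw
  have : ∀ e : VertexPair n, IsProbabilityMeasure
      (open Classical in if SameCluster P e then fp.toMeasure else fm.toMeasure) := by
    intro e
    split_ifs <;> infer_instance
  infer_instance

open Classical in
/-- The probability of the value `a` at an entry between `v` and the cluster of `c`. -/
noncomputable def valueProb {n : ℕ} {S : Finset ℝ} (fp fm : PMF S) (P : Setoid (Fin n))
    (v c : Fin n) (a : S) : ℝ :=
  if P v c then (fp a).toReal else (fm a).toReal

theorem sameCluster_mk {n : ℕ} {P : Setoid (Fin n)} {v u : Fin n} (h : ¬ (s(v, u)).IsDiag) :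
    SameCluster P ⟨s(v, u), h⟩ ↔ P v u := by
  constructor
  · intro H
    exact H v (by simp) u (by simp)
  · intro H x hx y hy
    simp only [Sym2.mem_iff] at hx hy
    rcases hx with rfl | rfl <;> rcases hy with rfl | rfl
    · exact P.refl _
    · exact H
    · exact P.symm H
    · exact P.refl _

open Classical in
-- The entries between `v` and the vertices of `T` sit at distinct unordered pairs, so they are
-- independent, and they share one law because `T` lies in one cluster. The set `T` is fixed before
-- `W` is drawn.
theorem sideInfoLaw_real_le_abs_valueFreq_sub {n : ℕ} {S : Finset ℝ} (fp fm : PMF S)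
    (P : Setoid (Fin n)) (v c : Fin n) (T : Finset (Fin n)) (hv : v ∉ T) (hT : ∀ u ∈ T, P u c)
    (hne : T.Nonempty) (a : S) {t : ℝ} (ht : 0 ≤ t) :
    (sideInfoLaw fp fm P).real
        {W | t ≤ |valueFreq (fun e => (W e : ℝ)) v T a - valueProb fp fm P v c a|}
      ≤ 2 * Real.exp (-2 * T.card * t ^ 2) := by
  set μ : VertexPair n → Measure S := fun e =>
    if SameCluster P e then fp.toMeasure else fm.toMeasure with hμ
  have hμp : ∀ e, IsProbabilityMeasure (μ e) := by
    intro e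
    simp only [hμ]
    split_ifs <;> infer_instance
  have hd : ∀ u ∈ T, ¬ (s(v, u)).IsDiag := by
    rintro u hu h
    rw [Sym2.mk_isDiag_iff] at h
    exact hv (h ▸ hu)
  set g : {u // u ∈ T} ↪ VertexPair n := ⟨fun u => ⟨s(v, u.1), hd u.1 u.2⟩, by
    intro u w huw
    simp only [Subtype.mk.injEq, Sym2.congr_right] at huw
    exact Subtype.ext huw⟩ with hg
  set s : Finset (VertexPair n) := T.attach.map g with hs
  have hcard : s.card = T.card := by simp [hs]
  have hp : ∀ e ∈ s, (μ e).real {a} = valueProb fp fm P v c a := by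
    intro e he
    obtain ⟨u, -, rfl⟩ := Finset.mem_map.mp he
    have h1 : SameCluster P (g u) ↔ P v c := by
      rw [hg]
      refine (sameCluster_mk _).trans ⟨fun h => P.trans h (hT _ u.2), fun h =>
        P.trans h (P.symm (hT _ u.2))⟩
    simp only [hμ, valueProb, h1]
    split_ifs <;>
    simp [measureReal_def, PMF.toMeasure_apply_singleton _ _ (measurableSet_singleton a)]
  have key := measureReal_pi_abs_card_sub_ge_le μ s a (valueProb fp fm P v c a) hp ht
  rw [hcard] at key
  refine le_trans (measureReal_mono fun W hW => ?_) key
  have hTpos : (0 : ℝ) < T.card := by exact_mod_cast hne.card_pos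
  have hcount : (s.filter fun e => W e = a).card
      = (T.filter fun u => sideEntry (fun e => (W e : ℝ)) v u = a).card := by
    rw [hs, Finset.filter_map, Finset.card_map]
    refine Finset.card_bij (fun u _ => u.1) ?_ ?_ ?_
    · intro u hu
      simp only [Finset.mem_filter, Finset.mem_attach, true_and, Function.comp_apply] at hu
      simp only [Finset.mem_filter, u.2, true_and, sideEntry, hd u.1 u.2, dite_false]
      exact congrArg Subtype.val hu
    · intro u _ w _ h
      exact Subtype.ext h
    · intro u hu
      simp only [Finset.mem_filter] at hu
      refine ⟨⟨u, hu.1⟩, ?_, rfl⟩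
      simp only [Finset.mem_filter, Finset.mem_attach, true_and, Function.comp_apply]
      have h2 := hu.2
      simp only [sideEntry, hd u hu.1, dite_false] at h2
      exact Subtype.ext h2
  simp only [Set.mem_ofPred_eq] at hW ⊢
  rw [hcount]
  rw [valueFreq] at hW
  calc t * T.card ≤ _ * T.card := mul_le_mul_of_nonneg_right hW hTpos.le
    _ = _ := by
      rw [← abs_of_pos hTpos, ← abs_mul, abs_of_pos hTpos]
      congr 1
      field_simp

/-- The side information for which all frequencies of the value `a` between a vertex and the earlier
vertices of a cluster are within `t` of their expectations, for clusters with `M` earlier vertices. -/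
def typicalAt {n : ℕ} {S : Finset ℝ} (fp fm : PMF S) (P : Setoid (Fin n)) (M : ℕ) (t : ℝ) (a : S) :
    Set (VertexPair n → S) :=
  {W | ∀ v c, M ≤ (earlierIn P v c).card →
    |valueFreq (fun e => (W e : ℝ)) v (earlierIn P v c) a - valueProb fp fm P v c a| < t}

/-- Union bound over all `(v, c)`; each set of earlier vertices is determined by `P`, so Hoeffding
applies to each pair separately. -/
theorem sideInfoLaw_real_compl_typicalAt_le {n : ℕ} {S : Finset ℝ} (fp fm : PMF S)
    (P : Setoid (Fin n)) {M : ℕ} (hM : 1 ≤ M) {t : ℝ} (ht : 0 ≤ t) (a : S) :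
    (sideInfoLaw fp fm P).real (typicalAt fp fm P M t a)ᶜ
      ≤ (n : ℝ) ^ 2 * (2 * Real.exp (-2 * M * t ^ 2)) := by
  have hsub : (typicalAt fp fm P M t a)ᶜ ⊆ ⋃ p ∈ (Finset.univ : Finset (Fin n × Fin n)),
      {W : VertexPair n → S | M ≤ (earlierIn P p.1 p.2).card ∧
        t ≤ |valueFreq (fun e => (W e : ℝ)) p.1 (earlierIn P p.1 p.2) a
          - valueProb fp fm P p.1 p.2 a|} := by
    intro W hW
    simp only [typicalAt, Set.mem_compl_iff, Set.mem_ofPred_eq, not_forall, not_lt] at hW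
    obtain ⟨v, c, h1, h2⟩ := hW
    simp only [Set.mem_iUnion]
    exact ⟨(v, c), Finset.mem_univ _, h1, h2⟩
  have hone : ∀ p : Fin n × Fin n, (sideInfoLaw fp fm P).real
      {W : VertexPair n → S | M ≤ (earlierIn P p.1 p.2).card ∧
        t ≤ |valueFreq (fun e => (W e : ℝ)) p.1 (earlierIn P p.1 p.2) a
          - valueProb fp fm P p.1 p.2 a|} ≤ 2 * Real.exp (-2 * M * t ^ 2) := by
    intro p
    by_cases h : M ≤ (earlierIn P p.1 p.2).card
    · simp only [h, true_and]
      refine (sideInfoLaw_real_le_abs_valueFreq_sub fp fm P p.1 p.2 _ ?_ ?_ ?_ a ht).trans ?_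
      · simp [mem_earlierIn]
      · exact fun u hu => (mem_earlierIn.mp hu).2
      · exact Finset.card_pos.mp (by omega)
      · have : (M : ℝ) ≤ (earlierIn P p.1 p.2).card := by exact_mod_cast h
        have : (M : ℝ) * t ^ 2 ≤ (earlierIn P p.1 p.2).card * t ^ 2 :=
          mul_le_mul_of_nonneg_right this (sq_nonneg t)
        gcongr ?_ * Real.exp ?_
        linarith
    · simp only [h, false_and, Set.ofPred_false, measureReal_empty]
      positivity
  calc _ ≤ _ := measureReal_mono hsub (measure_ne_top _ _)
    _ ≤ ∑ p ∈ (Finset.univ : Finset (Fin n × Fin n)), _ := measureReal_biUnion_finset_le _ _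
    _ ≤ ∑ p ∈ (Finset.univ : Finset (Fin n × Fin n)), 2 * Real.exp (-2 * M * t ^ 2) :=
        Finset.sum_le_sum fun p _ => hone p
    _ = _ := by
        rw [Finset.sum_const, nsmul_eq_mul, Finset.card_univ, Fintype.card_prod, Fintype.card_fin]
        push_cast
        ring

/-- The side information that is typical for every value. -/
def typical {n : ℕ} {S : Finset ℝ} (fp fm : PMF S) (P : Setoid (Fin n)) (M : ℕ) (t : ℝ) :
    Set (VertexPair n → S) :=
  ⋂ a, typicalAt fp fm P M t a

theorem sideInfoLaw_real_compl_typical_le {n : ℕ} {S : Finset ℝ} (fp fm : PMF S)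
    (P : Setoid (Fin n)) {M : ℕ} (hM : 1 ≤ M) {t : ℝ} (ht : 0 ≤ t) :
    (sideInfoLaw fp fm P).real (typical fp fm P M t)ᶜ
      ≤ S.card * ((n : ℝ) ^ 2 * (2 * Real.exp (-2 * M * t ^ 2))) := by
  rw [typical, Set.compl_iInter]
  refine (measureReal_iUnion_fintype_le _).trans ?_
  refine (Finset.sum_le_card_nsmul _ _ _ fun a _ =>
    sideInfoLaw_real_compl_typicalAt_le fp fm P hM ht a).trans_eq ?_
  rw [Finset.card_univ, Fintype.card_coe, nsmul_eq_mul]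

/-! ## Sequential clustering by queries to representatives -/

section Representatives

variable {n : ℕ}

open Classical in
/-- The first vertex of the cluster of `u`. -/
noncomputable def firstIn (P : Setoid (Fin n)) (u : Fin n) : Fin n :=
  (Finset.univ.filter fun w => P u w).min' ⟨u, by simp⟩

open Classical in
theorem rel_firstIn (P : Setoid (Fin n)) (u : Fin n) : P u (firstIn P u) :=
  (Finset.mem_filter.mp (Finset.min'_mem _ _)).2

theorem firstIn_le {P : Setoid (Fin n)} {u w : Fin n} (h : P u w) : firstIn P u ≤ w := by
  classical
  exact Finset.min'_le _ _ (by simpa using h)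

theorem firstIn_eq_iff {P : Setoid (Fin n)} {u w : Fin n} :
    firstIn P u = firstIn P w ↔ P u w := by
  constructor
  · intro h
    exact P.trans (rel_firstIn P u) (h ▸ P.symm (rel_firstIn P w))
  · intro h
    exact le_antisymm (firstIn_le (P.trans h (rel_firstIn P w)))
      (firstIn_le (P.trans (P.symm h) (rel_firstIn P u)))

theorem firstIn_firstIn (P : Setoid (Fin n)) (u : Fin n) :
    firstIn P (firstIn P u) = firstIn P u :=
  firstIn_eq_iff.mpr (P.symm (rel_firstIn P u))

theorem ker_firstIn (P : Setoid (Fin n)) : Setoid.ker (firstIn P) = P :=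
  Setoid.ext fun _ _ => firstIn_eq_iff

theorem card_le_numClusters {P : Setoid (Fin n)} {R : Finset (Fin n)}
    (hR : ∀ u ∈ R, ∀ w ∈ R, P u w → u = w) : R.card ≤ numClusters P := by
  classical
  rw [numClusters, Nat.card_eq_fintype_card, ← Finset.card_univ]
  refine Finset.card_le_card_of_injOn (fun u => Quotient.mk P u) (fun _ _ => Finset.mem_univ _) ?_
  intro u hu w hw h
  exact hR u hu w hw (Quotient.exact h)

theorem numClusters_le (P : Setoid (Fin n)) : numClusters P ≤ n := by
  classical
  rw [numClusters, Nat.card_eq_fintype_card]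
  simpa using Fintype.card_quotient_le P

/-- The representatives among the vertices before `v`, if the clusters are the fibers of `r`. -/
def repsBefore (v : Fin n) (r : Fin n → Fin n) : Finset (Fin n) :=
  Finset.univ.filter fun c => c < v ∧ r c = c

/-- The vertices before `v` with representative `c`. -/
def fiberBefore (v : Fin n) (r : Fin n → Fin n) (c : Fin n) : Finset (Fin n) :=
  Finset.univ.filter fun u => u < v ∧ r u = c

theorem mem_repsBefore {v c : Fin n} {r : Fin n → Fin n} :
    c ∈ repsBefore v r ↔ c < v ∧ r c = c := by
  simp [repsBefore]

theorem mem_fiberBefore {v c u : Fin n} {r : Fin n → Fin n} :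
    u ∈ fiberBefore v r c ↔ u < v ∧ r u = c := by
  simp [fiberBefore]

/-- The representatives that are known before `v` is processed. -/
noncomputable def repsAt (P : Setoid (Fin n)) (v u : Fin n) : Fin n :=
  if u < v then firstIn P u else u

theorem repsAt_of_lt {P : Setoid (Fin n)} {v u : Fin n} (h : u < v) :
    repsAt P v u = firstIn P u := if_pos h

theorem mem_repsBefore_repsAt {P : Setoid (Fin n)} {v c : Fin n} :
    c ∈ repsBefore v (repsAt P v) ↔ c < v ∧ firstIn P c = c := by
  rw [mem_repsBefore]
  exact and_congr_right fun h => by rw [repsAt_of_lt h]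

/-- Decouples the algorithm from the randomness: on a correct run, the sets whose frequencies are
inspected do not depend on `W`. -/
theorem fiberBefore_repsAt {P : Setoid (Fin n)} {v c : Fin n}
    (h : c ∈ repsBefore v (repsAt P v)) : fiberBefore v (repsAt P v) c = earlierIn P v c := by
  rw [mem_repsBefore_repsAt] at h
  ext u
  rw [mem_fiberBefore, mem_earlierIn]
  refine and_congr_right fun hu => ?_
  rw [repsAt_of_lt hu, ← firstIn_eq_iff, h.2]

theorem firstIn_mem_repsBefore {P : Setoid (Fin n)} {v u : Fin n} (hu : u < v) (h : P v u) :
    firstIn P v ∈ repsBefore v (repsAt P v) :=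
  mem_repsBefore_repsAt.mpr ⟨(firstIn_le h).trans_lt hu, firstIn_firstIn P v⟩

theorem eq_firstIn_of_mem_repsBefore {P : Setoid (Fin n)} {v c : Fin n}
    (h : c ∈ repsBefore v (repsAt P v)) (hc : P v c) : c = firstIn P v := by
  rw [mem_repsBefore_repsAt] at h
  rw [← h.2]
  exact firstIn_eq_iff.mpr (P.symm hc)

theorem card_repsBefore_repsAt_le (P : Setoid (Fin n)) (v : Fin n) :
    (repsBefore v (repsAt P v)).card ≤ numClusters P := by
  refine card_le_numClusters fun u hu w hw h => ?_
  rw [mem_repsBefore_repsAt] at hu hw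
  rw [← hu.2, ← hw.2]
  exact firstIn_eq_iff.mpr h

theorem earlierIn_congr {P : Setoid (Fin n)} {v c d : Fin n} (h : P c d) :
    earlierIn P v c = earlierIn P v d := by
  ext u
  simp only [mem_earlierIn]
  exact and_congr_right fun _ => ⟨fun h1 => P.trans h1 h, fun h1 => P.trans h1 (P.symm h)⟩

/-- At most `k * M` vertices have fewer than `M` earlier vertices in their cluster. -/
theorem card_filter_earlierIn_lt_le (P : Setoid (Fin n)) (M : ℕ) :
    (Finset.univ.filter fun v => (earlierIn P v v).card < M).card ≤ M * numClusters P := by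
  classical
  set s := Finset.univ.filter fun v => (earlierIn P v v).card < M with hs
  refine (Finset.card_le_mul_card_image (f := firstIn P) s M ?_).trans ?_
  · intro b _
    -- Within one cluster the number of earlier members increases strictly with the vertex, so at
    -- most `M` members have a value below `M`.
    have : (s.filter fun a => firstIn P a = b).card ≤ (Finset.range M).card := by
      refine Finset.card_le_card_of_injOn (fun v => (earlierIn P v v).card) ?_ ?_
      · intro v hv
        simp only [hs, Finset.coe_filter, Finset.mem_filter, Finset.mem_univ, true_and,
          Set.mem_ofPred_eq] at hv
        simpa using hv.1
      · have hlt : ∀ v w : Fin n, P v w → v < w →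
            (earlierIn P v v).card < (earlierIn P w w).card := by
          intro v w h hvw
          refine Finset.card_lt_card ?_
          rw [earlierIn_congr h, Finset.ssubset_iff_of_subset]
          · exact ⟨v, mem_earlierIn.mpr ⟨hvw, h⟩, by simp [mem_earlierIn]⟩
          · intro u hu
            rw [mem_earlierIn] at hu ⊢
            exact ⟨hu.1.trans hvw, hu.2⟩
        intro v hv w hw h
        simp only [Finset.coe_filter, Set.mem_ofPred_eq] at hv hw
        have hP : P v w := firstIn_eq_iff.mp (hv.2.trans hw.2.symm)
        rcases lt_trichotomy v w with h1 | h1 | h1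
        · exact absurd h (hlt v w hP h1).ne
        · exact h1
        · exact absurd h (hlt w v (P.symm hP) h1).ne'
    simpa using this
  · refine Nat.mul_le_mul_left _ (card_le_numClusters ?_)
    intro u hu w hw h
    obtain ⟨u, -, rfl⟩ := Finset.mem_image.mp hu
    obtain ⟨w, -, rfl⟩ := Finset.mem_image.mp hw
    rw [← firstIn_firstIn P u, ← firstIn_firstIn P w]
    exact firstIn_eq_iff.mpr h

end Representatives

/-! ### The strategy that verifies its hints -/

namespace QueryTree

variable {n : ℕ}

/-- Query `v` with the vertices of a list until the answer is positive. -/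
def tryList (v : Fin n) (yes : Fin n → QueryTree n) (no : QueryTree n) :
    List (Fin n) → QueryTree n
  | [] => no
  | c :: L => query v c fun b => bif b then yes c else tryList v yes no L

section tryList

variable {P : Setoid (Fin n)} {v : Fin n} {yes : Fin n → QueryTree n} {no : QueryTree n}

theorem result_tryList_of_forall_not {L : List (Fin n)} (h : ∀ c ∈ L, ¬ P v c) :
    (tryList v yes no L).result (perfectOracle P) = no.result (perfectOracle P) := by
  induction L with
  | nil => rfl
  | cons c L ih =>
    have hc : perfectOracle P v c = false := by simpa [perfectOracle] using h c (by simp)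
    simpa [tryList, result, hc] using ih fun d hd => h d (by simp [hd])

theorem cost_tryList_of_forall_not {L : List (Fin n)} (h : ∀ c ∈ L, ¬ P v c) :
    (tryList v yes no L).cost (perfectOracle P) = L.length + no.cost (perfectOracle P) := by
  induction L with
  | nil => simp [tryList]
  | cons c L ih =>
    have hc : perfectOracle P v c = false := by simpa [perfectOracle] using h c (by simp)
    have := ih fun d hd => h d (by simp [hd])
    simp only [tryList, cost, hc, cond_false, this, List.length_cons]
    omega

/-- If some vertex of the list `L` is in the cluster of `v`, then the answer is positive after at most
`L.length` queries. -/
theorem exists_tryList_append {L L' : List (Fin n)} (h : ∃ c ∈ L, P v c) :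
    ∃ d ∈ L, P v d ∧
      (tryList v yes no (L ++ L')).result (perfectOracle P) = (yes d).result (perfectOracle P) ∧
      (tryList v yes no (L ++ L')).cost (perfectOracle P)
        ≤ L.length + (yes d).cost (perfectOracle P) := by
  induction L with
  | nil => simp at h
  | cons c L ih =>
    by_cases hc : P v c
    · have hc' : perfectOracle P v c = true := by simpa [perfectOracle] using hc
      refine ⟨c, by simp, hc, ?_, ?_⟩
      · simp [tryList, result, hc']
      · simp only [List.cons_append, tryList, cost, hc', cond_true, List.length_cons]
        omega
    · have hc' : perfectOracle P v c = false := by simpa [perfectOracle] using hc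
      obtain ⟨d, hd, h1, h2, h3⟩ := ih (by
        obtain ⟨d, hd, h1⟩ := h
        rcases List.mem_cons.mp hd with rfl | hd
        · exact absurd h1 hc
        · exact ⟨d, hd, h1⟩)
      refine ⟨d, by simp [hd], h1, ?_, ?_⟩
      · simpa [tryList, result, hc'] using h2
      · simp only [List.cons_append, tryList, cost, hc', cond_false, List.length_cons]
        omega

end tryList

/-- Process the vertices of a list in order: query each vertex with the hints given by `H`, then with
all known representatives, until its cluster is found. -/
def guided (H : Fin n → (Fin n → Fin n) → List (Fin n)) :
    List (Fin n) → (Fin n → Fin n) → QueryTree n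
  | [], r => output (Setoid.ker r)
  | v :: vs, r =>
      tryList v (fun c => guided H vs (Function.update r v (r c))) (guided H vs r)
        (H v r ++ (repsBefore v r).sort (· ≤ ·))

/-- The vertices that remain to be processed are those of `l`, in increasing order. -/
structure IsTail (l : List (Fin n)) : Prop where
  sorted : l.Pairwise (· < ·)
  lt_of_notMem : ∀ u ∉ l, ∀ v ∈ l, u < v

theorem isTail_finRange (n : ℕ) : IsTail (List.finRange n) where
  sorted := List.pairwise_lt_finRange n
  lt_of_notMem u hu := absurd (List.mem_finRange u) hu

namespace IsTail

variable {v : Fin n} {vs : List (Fin n)}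

theorem notMem_iff (h : IsTail (v :: vs)) {u : Fin n} : u ∉ v :: vs ↔ u < v := by
  refine ⟨fun hu => h.lt_of_notMem u hu v (by simp), fun hu hmem => ?_⟩
  rcases List.mem_cons.mp hmem with rfl | hmem
  · exact lt_irrefl _ hu
  · exact lt_asymm hu (List.rel_of_pairwise_cons h.sorted hmem)

theorem tail (h : IsTail (v :: vs)) : IsTail vs where
  sorted := h.sorted.of_cons
  lt_of_notMem u hu w hw := by
    by_cases huv : u = v
    · exact huv ▸ List.rel_of_pairwise_cons h.sorted hw
    · exact h.lt_of_notMem u (by simp [huv, hu]) w (by simp [hw])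

theorem notMem (h : IsTail (v :: vs)) : v ∉ vs :=
  fun hv => lt_irrefl _ (List.rel_of_pairwise_cons h.sorted hv)

end IsTail

/-- The known representatives when the vertices of `l` remain to be processed. -/
noncomputable def repsWith (P : Setoid (Fin n)) (l : List (Fin n)) (u : Fin n) : Fin n :=
  if u ∈ l then u else firstIn P u

variable {P : Setoid (Fin n)} {v : Fin n} {vs : List (Fin n)}

theorem repsWith_cons (h : IsTail (v :: vs)) : repsWith P (v :: vs) = repsAt P v := by
  funext u
  unfold repsWith repsAt
  by_cases hu : u < v
  · rw [if_pos hu, if_neg (h.notMem_iff.mpr hu)]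
  · rw [if_neg hu, if_pos (by_contra fun h' => hu (h.notMem_iff.mp h'))]

theorem repsWith_nil : repsWith P [] = firstIn P := by
  funext u
  simp [repsWith]

theorem repsWith_finRange : repsWith P (List.finRange n) = id := by
  funext u
  simp [repsWith]

theorem update_repsAt (h : IsTail (v :: vs)) :
    Function.update (repsAt P v) v (firstIn P v) = repsWith P vs := by
  rw [← repsWith_cons h]
  funext u
  by_cases hu : u = v
  · subst hu
    simp [repsWith, h.notMem]
  · simp [repsWith, hu]

/-- An unprocessed vertex is its own default representative, so opening a new cluster needs no
update. -/
theorem repsAt_eq_repsWith_of_forall_not (h : IsTail (v :: vs)) (hv : ∀ u < v, ¬ P v u) :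
    repsAt P v = repsWith P vs := by
  rw [← update_repsAt h]
  have : firstIn P v = v := by
    by_contra hne
    exact hv _ (lt_of_le_of_ne (firstIn_le (P.refl v)) hne) (rel_firstIn P v)
  rw [this]
  funext u
  by_cases hu : u = v
  · subst hu
    simp [repsAt]
  · simp [hu]

open Classical in
-- A vertex joins a cluster only after a positive answer, so the state stays correct whatever the
-- hints are. A wrong list of hints costs its own length and then at most one query per known
-- cluster.
theorem guided_spec {H : Fin n → (Fin n → Fin n) → List (Fin n)}
    (hH : ∀ v r, ∀ c ∈ H v r, c ∈ repsBefore v r) (P : Setoid (Fin n)) {l : List (Fin n)}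
    (hl : IsTail l) :
    (guided H l (repsWith P l)).result (perfectOracle P) = P ∧
      (guided H l (repsWith P l)).cost (perfectOracle P) ≤
        (l.map fun v => (H v (repsAt P v)).length +
          if ∃ c ∈ H v (repsAt P v), P v c then 0 else numClusters P).sum := by
  induction l with
  | nil => simp [guided, result, cost, repsWith_nil, ker_firstIn]
  | cons v vs ih =>
    obtain ⟨ih1, ih2⟩ := ih hl.tail
    rw [repsWith_cons hl, guided, List.map_cons, List.sum_cons]
    set r := repsAt P v with hr
    have hyes : ∀ d ∈ repsBefore v r, P v d → Function.update r v (r d) = repsWith P vs := by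
      intro d hd hP
      rw [(mem_repsBefore.mp hd).2, eq_firstIn_of_mem_repsBefore hd hP, hr, update_repsAt hl]
    by_cases h1 : ∃ c ∈ H v r, P v c
    · obtain ⟨d, hd, hP, hres, hcost⟩ := exists_tryList_append
        (yes := fun c => guided H vs (Function.update r v (r c))) (no := guided H vs r)
        (L' := (repsBefore v r).sort (· ≤ ·)) h1
      rw [hyes d (hH v r d hd) hP] at hres hcost
      refine ⟨hres.trans ih1, ?_⟩
      rw [if_pos h1]
      omega
    · rw [if_neg h1]
      have hlen : ((repsBefore v r).sort (· ≤ ·)).length ≤ numClusters P := by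
        rw [Finset.length_sort]
        exact card_repsBefore_repsAt_le P v
      by_cases h2 : ∃ u < v, P v u
      · obtain ⟨u, hu, hPu⟩ := h2
        have hmem := firstIn_mem_repsBefore hu hPu
        obtain ⟨d, hd, hP, hres, hcost⟩ := exists_tryList_append
          (yes := fun c => guided H vs (Function.update r v (r c))) (no := guided H vs r)
          (L := H v r ++ (repsBefore v r).sort (· ≤ ·)) (L' := [])
          ⟨firstIn P v, by simpa using Or.inr hmem, rel_firstIn P v⟩
        rw [List.append_nil] at hres hcost
        have hd' : d ∈ repsBefore v r := by
          rcases List.mem_append.mp hd with hd | hd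
          · exact hH v r d hd
          · simpa using hd
        rw [hyes d hd' hP] at hres hcost
        rw [List.length_append] at hcost
        exact ⟨hres.trans ih1, by omega⟩
      · push Not at h2
        have h3 : ∀ c ∈ H v r ++ (repsBefore v r).sort (· ≤ ·), ¬ P v c := by
          intro c hc
          rcases List.mem_append.mp hc with hc | hc
          · exact h2 c (mem_repsBefore.mp (hH v r c hc)).1
          · exact h2 c (mem_repsBefore.mp (by simpa using hc)).1
        rw [result_tryList_of_forall_not h3, cost_tryList_of_forall_not h3, List.length_append]
        have h4 : guided H vs r = guided H vs (repsWith P vs) :=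
          congrArg _ (repsAt_eq_repsWith_of_forall_not hl h2)
        rw [h4]
        exact ⟨ih1, by omega⟩

end QueryTree

/-! ### The strategy that trusts its proposals, and its worst-case cost -/

namespace QueryTree

variable {n : ℕ}

/-- Process the vertices of a list in order: assign a vertex to the cluster proposed by `D` without a
query, and query it with all known representatives if there is no proposal. Stop if the answers
place it into a cluster of at least `M` vertices. -/
def trusting (D : Fin n → (Fin n → Fin n) → Option (Fin n)) (M : ℕ) :
    List (Fin n) → (Fin n → Fin n) → QueryTree n
  | [], r => output (Setoid.ker r)
  | v :: vs, r =>
      match D v r with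
      | some c => trusting D M vs (Function.update r v c)
      | none =>
          tryList v
            (fun c => if M ≤ (fiberBefore v r c).card then output ⊥
              else trusting D M vs (Function.update r v c))
            (trusting D M vs r) ((repsBefore v r).sort (· ≤ ·))

theorem exists_tryList {P : Setoid (Fin n)} {v : Fin n} {yes : Fin n → QueryTree n}
    {no : QueryTree n} {L : List (Fin n)} (h : ∃ c ∈ L, P v c) :
    ∃ d ∈ L, P v d ∧
      (tryList v yes no L).result (perfectOracle P) = (yes d).result (perfectOracle P) ∧
      (tryList v yes no L).cost (perfectOracle P)
        ≤ L.length + (yes d).cost (perfectOracle P) := by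
  simpa only [List.append_nil] using exists_tryList_append (yes := yes) (no := no) (L' := []) h

/-- The hypotheses constrain `D` only at the correct states, which suffices because a correct run
visits no others. By `hnone`, the abort is never triggered there. -/
theorem result_trusting {D : Fin n → (Fin n → Fin n) → Option (Fin n)} {M : ℕ}
    {P : Setoid (Fin n)}
    (hsome : ∀ v c, D v (repsAt P v) = some c → c = firstIn P v)
    (hnone : ∀ v, D v (repsAt P v) = none → (earlierIn P v v).card < M) {l : List (Fin n)}
    (hl : IsTail l) :
    (trusting D M l (repsWith P l)).result (perfectOracle P) = P := by
  induction l with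
  | nil => simp [trusting, result, repsWith_nil, ker_firstIn]
  | cons v vs ih =>
    have ih := ih hl.tail
    rw [repsWith_cons hl, trusting]
    cases hD : D v (repsAt P v) with
    | some c =>
      simp only
      rw [hsome v c hD, update_repsAt hl, ih]
    | none =>
      simp only
      by_cases h : ∃ u < v, P v u
      · obtain ⟨u, hu, hPu⟩ := h
        obtain ⟨d, hd, hP, hres, -⟩ := exists_tryList
          (yes := fun c => if M ≤ (fiberBefore v (repsAt P v) c).card then output ⊥
              else trusting D M vs (Function.update (repsAt P v) v c))
          (no := trusting D M vs (repsAt P v))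
          (L := (repsBefore v (repsAt P v)).sort (· ≤ ·))
          ⟨firstIn P v, by simpa using firstIn_mem_repsBefore hu hPu, rel_firstIn P v⟩
        have hd' : d ∈ repsBefore v (repsAt P v) := by simpa using hd
        rw [hres, fiberBefore_repsAt hd', ← earlierIn_congr hP, if_neg (hnone v hD).not_ge,
          eq_firstIn_of_mem_repsBefore hd' hP, update_repsAt hl, ih]
      · push Not at h
        rw [result_tryList_of_forall_not, repsAt_eq_repsWith_of_forall_not hl h, ih]
        intro c hc
        exact h c (mem_repsBefore.mp (by simpa using hc)).1

/-- The state of `trusting` when the vertices of `l` remain to be processed and those of `Q` have been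
queried. -/
structure TrustingState (P : Setoid (Fin n)) (M : ℕ) (l : List (Fin n)) (r : Fin n → Fin n)
    (Q : Finset (Fin n)) : Prop where
  eq_self : ∀ u ∈ l, r u = u
  map_notMem : ∀ u ∉ l, r u ∉ l
  map_map : ∀ u ∉ l, r (r u) = r u
  distinct : ∀ u ∉ l, ∀ w ∉ l, r u = u → r w = w → P u w → u = w
  queried : ∀ u ∈ Q, u ∉ l
  card_fiber : ∀ c, (Q.filter fun u => r u = c).card ≤ M

namespace TrustingState

variable {P : Setoid (Fin n)} {M : ℕ} {l : List (Fin n)} {r : Fin n → Fin n} {Q : Finset (Fin n)}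
  {v : Fin n} {vs : List (Fin n)}

/-- The fibers of `r` hold at most `M` queried vertices each, and representatives lie in distinct
clusters of `P`. The fibers themselves need not respect `P`. -/
theorem card_le (h : TrustingState P M l r Q) : Q.card ≤ M * numClusters P := by
  classical
  refine (Finset.card_le_mul_card_image_of_maps_to (f := r)
    (t := Finset.univ.filter fun c => c ∉ l ∧ r c = c) ?_ M fun c _ => h.card_fiber c).trans
    (Nat.mul_le_mul_left _ (card_le_numClusters ?_))
  · intro u hu
    have := h.queried u hu
    simp [h.map_notMem u this, h.map_map u this]
  · intro u hu w hw
    simp only [Finset.mem_filter, Finset.mem_univ, true_and] at hu hw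
    exact h.distinct u hu.1 w hw.1 hu.2 hw.2

theorem card_repsBefore_le (h : TrustingState P M (v :: vs) r Q) (hl : IsTail (v :: vs)) :
    (repsBefore v r).card ≤ numClusters P := by
  refine card_le_numClusters fun u hu w hw => ?_
  rw [mem_repsBefore] at hu hw
  exact h.distinct u (hl.notMem_iff.mpr hu.1) w (hl.notMem_iff.mpr hw.1) hu.2 hw.2

/-- No relation between `v` and `c` in `P` is needed: a wrong assignment creates no new
representative and leaves the queried vertices in their fibers. -/
theorem assign (h : TrustingState P M (v :: vs) r Q) (hl : IsTail (v :: vs)) {c : Fin n}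
    (hc : c ∈ repsBefore v r) : TrustingState P M vs (Function.update r v c) Q := by
  rw [mem_repsBefore] at hc
  have hvs : ∀ u ∉ vs, u ≠ v → u ∉ v :: vs := fun u hu huv => by simp [hu, huv]
  have hcv : c ≠ v := hc.1.ne
  have hcl : c ∉ v :: vs := hl.notMem_iff.mpr hc.1
  refine ⟨?_, ?_, ?_, ?_, ?_, ?_⟩
  · intro u hu
    have huv : u ≠ v := fun h' => hl.notMem (h' ▸ hu)
    rw [Function.update_of_ne huv]
    exact h.eq_self u (by simp [hu])
  · intro u hu
    by_cases huv : u = v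
    · subst huv
      simpa using fun h' => hcl (List.mem_cons_of_mem _ h')
    · rw [Function.update_of_ne huv]
      exact fun h' => h.map_notMem u (hvs u hu huv) (List.mem_cons_of_mem _ h')
  · intro u hu
    by_cases huv : u = v
    · subst huv
      simp [hcv, hc.2]
    · have h1 := h.map_notMem u (hvs u hu huv)
      have h2 : r u ≠ v := fun h' => h1 (by simp [h'])
      rw [Function.update_of_ne huv, Function.update_of_ne h2, h.map_map u (hvs u hu huv)]
  · intro u hu w hw hru hrw
    have huv : u ≠ v := by
      rintro rfl
      rw [Function.update_self] at hru
      exact hcv hru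
    have hwv : w ≠ v := by
      rintro rfl
      rw [Function.update_self] at hrw
      exact hcv hrw
    rw [Function.update_of_ne huv] at hru
    rw [Function.update_of_ne hwv] at hrw
    exact h.distinct u (hvs u hu huv) w (hvs w hw hwv) hru hrw
  · intro u hu hmem
    exact h.queried u hu (List.mem_cons_of_mem _ hmem)
  · intro d
    have : (Q.filter fun u => Function.update r v c u = d) = Q.filter fun u => r u = d := by
      refine Finset.filter_congr fun u hu => ?_
      have huv : u ≠ v := fun h' => h.queried u hu (by simp [h'])
      rw [Function.update_of_ne huv]
    rw [this]
    exact h.card_fiber d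

/-- The abort rule supplies `hM`, which leaves room for one more queried vertex in the fiber of `c`.
-/
theorem insert_assign (h : TrustingState P M (v :: vs) r Q) (hl : IsTail (v :: vs)) {c : Fin n}
    (hc : c ∈ repsBefore v r) (hM : (fiberBefore v r c).card < M) :
    TrustingState P M vs (Function.update r v c) (insert v Q) := by
  have h1 := h.assign hl hc
  refine ⟨h1.eq_self, h1.map_notMem, h1.map_map, h1.distinct, ?_, ?_⟩
  · intro u hu
    rcases Finset.mem_insert.mp hu with rfl | hu
    · exact hl.notMem
    · exact h1.queried u hu
  · intro d
    rw [Finset.filter_insert, Function.update_self]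
    split_ifs with hd
    · subst hd
      refine (Finset.card_insert_le _ _).trans ((Nat.succ_le_succ (Finset.card_le_card ?_)).trans hM)
      intro u hu
      rw [Finset.mem_filter] at hu
      have hul := h.queried u hu.1
      have huv : u ≠ v := fun h' => hul (by simp [h'])
      rw [Function.update_of_ne huv] at hu
      exact mem_fiberBefore.mpr ⟨hl.notMem_iff.mp hul, hu.2⟩
    · exact h1.card_fiber d

/-- Negative answers from all representatives are what keeps the representatives in distinct
clusters of `P`. -/
theorem insert_new (h : TrustingState P M (v :: vs) r Q) (hl : IsTail (v :: vs)) (hM : 1 ≤ M)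
    (hv : ∀ c ∈ repsBefore v r, ¬ P v c) : TrustingState P M vs r (insert v Q) := by
  have hvs : ∀ u ∉ vs, u ≠ v → u ∉ v :: vs := fun u hu huv => by simp [hu, huv]
  have hrv : r v = v := h.eq_self v (by simp)
  have hrep : ∀ u ∉ vs, u ≠ v → r u = u → u ∈ repsBefore v r := fun u hu huv hru =>
    mem_repsBefore.mpr ⟨hl.notMem_iff.mp (hvs u hu huv), hru⟩
  refine ⟨fun u hu => h.eq_self u (by simp [hu]), ?_, ?_, ?_, ?_, ?_⟩
  · intro u hu
    by_cases huv : u = v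
    · rwa [huv, hrv, ← huv]
    · exact fun h' => h.map_notMem u (hvs u hu huv) (List.mem_cons_of_mem _ h')
  · intro u hu
    by_cases huv : u = v
    · rw [huv, hrv, hrv]
    · exact h.map_map u (hvs u hu huv)
  · intro u hu w hw hru hrw hP
    by_cases huv : u = v <;> by_cases hwv : w = v
    · rw [huv, hwv]
    · exact absurd (huv ▸ hP) (hv w (hrep w hw hwv hrw))
    · exact absurd (hwv ▸ P.symm hP) (hv u (hrep u hu huv hru))
    · exact h.distinct u (hvs u hu huv) w (hvs w hw hwv) hru hrw hP
  · intro u hu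
    rcases Finset.mem_insert.mp hu with rfl | hu
    · exact hl.notMem
    · exact fun h' => h.queried u hu (List.mem_cons_of_mem _ h')
  · intro d
    rw [Finset.filter_insert]
    split_ifs with hd
    -- Here `d = v`, and no processed vertex has the unprocessed `v` as representative, so the new
    -- fiber contains only `v`.
    · have : (Q.filter fun u => r u = d) = ∅ := by
        refine Finset.filter_eq_empty_iff.mpr fun u hu hud => ?_
        exact h.map_notMem u (h.queried u hu) (by simp [hud, ← hd, hrv])
      rw [this]
      simpa using hM
    · exact h.card_fiber d

theorem card_insert (h : TrustingState P M (v :: vs) r Q) : (insert v Q).card = Q.card + 1 :=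
  Finset.card_insert_of_notMem fun hv => h.queried v hv (by simp)

end TrustingState

/-- The right side is a budget of `k` queries for each vertex that may still be queried. The `+ 1`
pays for the vertex whose answer causes the abort, when `Q` may already be full. -/
theorem cost_trusting_le {D : Fin n → (Fin n → Fin n) → Option (Fin n)}
    (hD : ∀ v r c, D v r = some c → c ∈ repsBefore v r) {M : ℕ} (hM : 1 ≤ M)
    {P : Setoid (Fin n)} {l : List (Fin n)} (hl : IsTail l) {r : Fin n → Fin n}
    {Q : Finset (Fin n)} (h : TrustingState P M l r Q) :
    (trusting D M l r).cost (perfectOracle P)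
      ≤ numClusters P * (M * numClusters P + 1 - Q.card) := by
  induction l generalizing r Q with
  | nil => simp [trusting, cost]
  | cons v vs ih =>
    rw [trusting]
    have hR := h.card_repsBefore_le hl
    have hQ := h.card_le
    have hstep : ∀ T : QueryTree n, T.cost (perfectOracle P)
        ≤ numClusters P * (M * numClusters P + 1 - (insert v Q).card) →
        ((repsBefore v r).sort (· ≤ ·)).length + T.cost (perfectOracle P)
          ≤ numClusters P * (M * numClusters P + 1 - Q.card) := by
      intro T hT
      rw [h.card_insert] at hT
      rw [Finset.length_sort]
      obtain ⟨m, hm⟩ : ∃ m, M * numClusters P = Q.card + m := Nat.exists_eq_add_of_le hQ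
      have e1 : M * numClusters P + 1 - Q.card = m + 1 := by omega
      have e2 : M * numClusters P + 1 - (Q.card + 1) = m := by omega
      rw [e2] at hT
      rw [e1, Nat.mul_succ]
      omega
    cases hDv : D v r with
    | some c => exact ih hl.tail (h.assign hl (hD v r c hDv))
    | none =>
      simp only
      by_cases hyes : ∃ c ∈ (repsBefore v r).sort (· ≤ ·), P v c
      · obtain ⟨d, hd, hP, -, hcost⟩ := exists_tryList
          (yes := fun c => if M ≤ (fiberBefore v r c).card then output ⊥
              else trusting D M vs (Function.update r v c))
          (no := trusting D M vs r) hyes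
        have hd' : d ∈ repsBefore v r := by simpa using hd
        refine hcost.trans (hstep _ ?_)
        split_ifs with hbig
        · simp [cost]
        · exact ih hl.tail (h.insert_assign hl hd' (not_le.mp hbig))
      · push Not at hyes
        rw [cost_tryList_of_forall_not hyes]
        exact hstep _ (ih hl.tail (h.insert_new hl hM fun c hc => hyes c (by simpa using hc)))

theorem cost_trusting_finRange_le {D : Fin n → (Fin n → Fin n) → Option (Fin n)}
    (hD : ∀ v r c, D v r = some c → c ∈ repsBefore v r) {M : ℕ} (hM : 1 ≤ M)
    (P : Setoid (Fin n)) :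
    (trusting D M (List.finRange n) id).cost (perfectOracle P)
      ≤ numClusters P * (M * numClusters P + 1) := by
  refine (cost_trusting_le hD hM (isTail_finRange n) (Q := ∅) ?_).trans_eq (by simp)
  refine ⟨fun _ _ => rfl, ?_, fun _ _ => rfl, ?_, ?_, ?_⟩ <;> simp

end QueryTree

/-! ## Proposals from the side information -/

section Proposals

variable {n : ℕ}

open Classical in
/-- A known cluster with at least `M` vertices in which the frequency of the value `a` towards `v` is
within `t` of `p`. -/
noncomputable def matchingRep (M : ℕ) (t a p : ℝ) (W : VertexPair n → ℝ) (v : Fin n)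
    (r : Fin n → Fin n) : Option (Fin n) :=
  if h : ∃ c ∈ repsBefore v r, M ≤ (fiberBefore v r c).card ∧
      |valueFreq W v (fiberBefore v r c) a - p| < t then some h.choose else none

theorem matchingRep_eq_some {M : ℕ} {t a p : ℝ} {W : VertexPair n → ℝ} {v c : Fin n}
    {r : Fin n → Fin n} (h : matchingRep M t a p W v r = some c) :
    c ∈ repsBefore v r ∧ M ≤ (fiberBefore v r c).card ∧
      |valueFreq W v (fiberBefore v r c) a - p| < t := by
  unfold matchingRep at h
  split_ifs at h with h'
  exact Option.some_injective _ h ▸ h'.choose_spec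

theorem matchingRep_ne_none {M : ℕ} {t a p : ℝ} {W : VertexPair n → ℝ} {v c : Fin n}
    {r : Fin n → Fin n} (hc : c ∈ repsBefore v r) (hM : M ≤ (fiberBefore v r c).card)
    (ht : |valueFreq W v (fiberBefore v r c) a - p| < t) : matchingRep M t a p W v r ≠ none := by
  unfold matchingRep
  rw [dif_pos ⟨c, hc, hM, ht⟩]
  simp

/-- The known clusters with at least `m` vertices. -/
def largeReps (m : ℕ) (v : Fin n) (r : Fin n → Fin n) : Finset (Fin n) :=
  (repsBefore v r).filter fun c => m ≤ (fiberBefore v r c).card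

/-- The frequencies of the cluster of `c` differ, in some value, from those of each other cluster in
`R` by more than those of any two other clusters in `R` differ in any value. -/
def IsIsolated (F : Fin n → ℝ → ℝ) (R : Finset (Fin n)) (c : Fin n) : Prop :=
  ∃ θ : ℝ, (∀ d ∈ R, d ≠ c → ∃ x, θ < |F c x - F d x|) ∧
    ∀ d ∈ R, d ≠ c → ∀ e ∈ R, e ≠ c → ∀ x, |F d x - F e x| ≤ θ

open Classical in
/-- An isolated cluster in `R`, if there is one. -/
noncomputable def isolatedRep (F : Fin n → ℝ → ℝ) (R : Finset (Fin n)) : Option (Fin n) :=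
  if h : ∃ c ∈ R, IsIsolated F R c then some h.choose else none

theorem isolatedRep_mem {F : Fin n → ℝ → ℝ} {R : Finset (Fin n)} {c : Fin n}
    (h : isolatedRep F R = some c) : c ∈ R := by
  unfold isolatedRep at h
  split_ifs at h with h'
  exact Option.some_injective _ h ▸ h'.choose_spec.1

/-- Compare with a third cluster `e`. Isolation of `c` makes its distance to `e` exceed `θ`, while
isolation of `d` bounds it by `θ'`, so `θ < θ'`. Exchanging the roles gives `θ' < θ`. -/
theorem IsIsolated.eq {F : Fin n → ℝ → ℝ} {R : Finset (Fin n)} (hR : 2 < R.card) {c d : Fin n}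
    (hcR : c ∈ R) (hdR : d ∈ R) (hc : IsIsolated F R c) (hd : IsIsolated F R d) : c = d := by
  by_contra hne
  obtain ⟨e, he, hne'⟩ : ∃ e ∈ R, e ∉ ({c, d} : Finset (Fin n)) := by
    by_contra! h
    exact absurd (Finset.card_le_card (h : R ⊆ {c, d})) (by
      have := Finset.card_le_two (a := c) (b := d)
      omega)
  simp only [Finset.mem_insert, Finset.mem_singleton, not_or] at hne'
  obtain ⟨θ, h1, h2⟩ := hc
  obtain ⟨θ', h3, h4⟩ := hd
  obtain ⟨x, hx⟩ := h1 e he hne'.1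
  obtain ⟨y, hy⟩ := h3 e he hne'.2
  have := h2 d hdR (Ne.symm hne) e he hne'.1 y
  have := h4 c hcR hne e he hne'.2 x
  linarith

theorem isolatedRep_eq_some {F : Fin n → ℝ → ℝ} {R : Finset (Fin n)} (hR : 2 < R.card) {c : Fin n}
    (hcR : c ∈ R) (hc : IsIsolated F R c) : isolatedRep F R = some c := by
  have h : ∃ c ∈ R, IsIsolated F R c := ⟨c, hcR, hc⟩
  rw [isolatedRep, dif_pos h,
    IsIsolated.eq hR h.choose_spec.1 hcR h.choose_spec.2 hc]

/-- Up to three proposals among the known clusters with at least `m` vertices: the isolated one, and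
the first two. -/
noncomputable def hintsOfSize (W : VertexPair n → ℝ) (v : Fin n) (r : Fin n → Fin n) (m : ℕ) :
    List (Fin n) :=
  (isolatedRep (fun c => valueFreq W v (fiberBefore v r c)) (largeReps m v r)).toList ++
    ((largeReps m v r).sort (· ≤ ·)).take 2

/-- The proposals for all powers of two up to `n`. -/
noncomputable def multiscaleHints (W : VertexPair n → ℝ) (v : Fin n) (r : Fin n → Fin n) :
    List (Fin n) :=
  (List.range (Nat.log 2 n + 1)).flatMap fun j => hintsOfSize W v r (2 ^ j)

theorem mem_repsBefore_of_mem_multiscaleHints {W : VertexPair n → ℝ} {v c : Fin n}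
    {r : Fin n → Fin n} (h : c ∈ multiscaleHints W v r) : c ∈ repsBefore v r := by
  obtain ⟨j, -, hc⟩ := List.mem_flatMap.mp h
  have hc' : c ∈ largeReps (2 ^ j) v r := by
    rcases List.mem_append.mp hc with hc | hc
    · exact isolatedRep_mem (Option.mem_toList.mp hc)
    · simpa using List.mem_of_mem_take hc
  exact (Finset.mem_filter.mp hc').1

theorem length_multiscaleHints_le (W : VertexPair n → ℝ) (v : Fin n) (r : Fin n → Fin n) :
    (multiscaleHints W v r).length ≤ 3 * (Nat.log 2 n + 1) := by
  have h : ∀ j, (hintsOfSize W v r (2 ^ j)).length ≤ 3 := by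
    intro j
    rw [hintsOfSize, List.length_append, List.length_take]
    have := Option.length_toList_le (o :=
      isolatedRep (fun c => valueFreq W v (fiberBefore v r c)) (largeReps (2 ^ j) v r))
    omega
  rw [multiscaleHints, List.length_flatMap]
  refine (List.sum_le_card_nsmul _ 3 ?_).trans_eq (by simp [mul_comm])
  simp only [List.mem_map]
  rintro _ ⟨j, -, rfl⟩
  exact h j

end Proposals

/-! ### Proposals are right on typical side information -/

section Typical

variable {n : ℕ} {S : Finset ℝ} {fp fm : PMF S} {P : Setoid (Fin n)} {M : ℕ} {t : ℝ} {a : S}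
  {W : VertexPair n → S} {v : Fin n}

/-- A foreign cluster that matched would have a frequency within `t` of both `fp a` and `fm a`,
which are at least `2 * t` apart. -/
theorem matchingRep_eq_firstIn (hW : W ∈ typicalAt fp fm P M t a)
    (ha : 2 * t ≤ |(fp a).toReal - (fm a).toReal|) {c : Fin n}
    (h : matchingRep M t a (fp a).toReal (fun e => (W e : ℝ)) v (repsAt P v) = some c) :
    c = firstIn P v := by
  obtain ⟨h1, h2, h3⟩ := matchingRep_eq_some h
  refine eq_firstIn_of_mem_repsBefore h1 ?_
  by_contra hP
  rw [fiberBefore_repsAt h1] at h2 h3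
  have h4 := hW v c h2
  rw [valueProb, if_neg hP] at h4
  have := abs_sub_le (fp a).toReal (valueFreq (fun e => (W e : ℝ)) v (earlierIn P v c) a)
    (fm a).toReal
  rw [abs_sub_comm (fp a).toReal (valueFreq _ _ _ _)] at this
  linarith

/-- If the own cluster had `M` earlier vertices, it would itself match on typical side information.
-/
theorem matchingRep_eq_none (hM : 1 ≤ M) (hW : W ∈ typicalAt fp fm P M t a)
    (h : matchingRep M t a (fp a).toReal (fun e => (W e : ℝ)) v (repsAt P v) = none) :
    (earlierIn P v v).card < M := by
  by_contra! hlt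
  obtain ⟨u, hu⟩ : (earlierIn P v v).Nonempty := Finset.card_pos.mp (by omega)
  rw [mem_earlierIn] at hu
  have hmem := firstIn_mem_repsBefore hu.1 (P.symm hu.2)
  have hE : earlierIn P v (firstIn P v) = earlierIn P v v :=
    (earlierIn_congr (rel_firstIn P v)).symm
  refine matchingRep_ne_none hmem ?_ ?_ h
  · rwa [fiberBefore_repsAt hmem, hE]
  · have := hW v v hlt
    rw [valueProb, if_pos (P.refl v)] at this
    rwa [fiberBefore_repsAt hmem, hE]

/-- Isolation is tested over all real values, since the algorithm does not know `S`; values outside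
`S` turn out to be harmless. Excluding `v` avoids the default `0` on the diagonal. -/
theorem valueFreq_eq_zero {x : ℝ} (hx : x ∉ S) (T : Finset (Fin n)) (hv : v ∉ T) :
    valueFreq (fun e => (W e : ℝ)) v T x = 0 := by
  have : (T.filter fun u => sideEntry (fun e => (W e : ℝ)) v u = x) = ∅ := by
    refine Finset.filter_eq_empty_iff.mpr fun u hu h => hx ?_
    have hd : ¬ (s(v, u)).IsDiag := by
      rw [Sym2.mk_isDiag_iff]
      exact fun h' => hv (h' ▸ hu)
    rw [sideEntry, dif_neg hd] at h
    exact h ▸ (W _).2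
  simp [valueFreq, this]

theorem firstIn_mem_hintsOfSize {m : ℕ} (hm : 1 ≤ m) (hMm : M ≤ m) (ht : 0 ≤ t)
    (hW : W ∈ typical fp fm P M t) (ha : 4 * t ≤ |(fp a).toReal - (fm a).toReal|)
    (hv : m ≤ (earlierIn P v v).card) :
    firstIn P v ∈ hintsOfSize (fun e => (W e : ℝ)) v (repsAt P v) m := by
  obtain ⟨u, hu⟩ : (earlierIn P v v).Nonempty := Finset.card_pos.mp (by omega)
  rw [mem_earlierIn] at hu
  have hmem := firstIn_mem_repsBefore hu.1 (P.symm hu.2)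
  set R := largeReps m v (repsAt P v) with hR
  have hmemR : firstIn P v ∈ R := by
    refine Finset.mem_filter.mpr ⟨hmem, ?_⟩
    rwa [fiberBefore_repsAt hmem, ← earlierIn_congr (rel_firstIn P v)]
  rw [hintsOfSize, List.mem_append]
  -- With at most two clusters an outlier is not well defined, and the first two representatives
  -- already contain the right one.
  by_cases hcard : R.card ≤ 2
  · right
    rw [List.take_of_length_le (by simpa using hcard)]
    simpa using hmemR
  left
  rw [Option.mem_toList]
  refine isolatedRep_eq_some (not_le.mp hcard) hmemR ?_
  have hfreq : ∀ d ∈ R, ∀ x : S,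
      |valueFreq (fun e => (W e : ℝ)) v (fiberBefore v (repsAt P v) d) x
        - valueProb fp fm P v d x| < t := by
    intro d hd x
    obtain ⟨h1, h2⟩ := Finset.mem_filter.mp hd
    rw [fiberBefore_repsAt h1] at h2 ⊢
    exact Set.mem_iInter.mp hW x v d (hMm.trans h2)
  have hother : ∀ d ∈ R, d ≠ firstIn P v → ¬ P v d := fun d hd hne hP =>
    hne (eq_firstIn_of_mem_repsBefore (Finset.mem_filter.mp hd).1 hP)
  -- At `a` the own frequency is near `fp a` and the foreign ones near `fm a`: a gap of at least `4
  -- * t` less two errors below `t` exceeds `2 * t`. Two foreign frequencies differ by less than `2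
  -- * t` at every value in `S`.
  refine ⟨2 * t, ?_, ?_⟩
  · intro d hd hne
    refine ⟨a, ?_⟩
    have h1 := hfreq _ hmemR a
    have h2 := hfreq d hd a
    rw [valueProb, if_pos (rel_firstIn P v)] at h1
    rw [valueProb, if_neg (hother d hd hne)] at h2
    rw [abs_lt] at h1 h2
    rcases le_abs.mp ha with h | h
    · exact lt_of_lt_of_le (by linarith) (le_abs_self _)
    · exact lt_of_lt_of_le (by linarith) (neg_le_abs _)
  · intro d hd hne e he hne' x
    by_cases hx : x ∈ S
    · have h1 := hfreq d hd ⟨x, hx⟩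
      have h2 := hfreq e he ⟨x, hx⟩
      rw [valueProb, if_neg (hother d hd hne)] at h1
      rw [valueProb, if_neg (hother e he hne')] at h2
      rw [abs_lt] at h1 h2
      rw [abs_le]
      constructor <;> linarith
    · beta_reduce
      rw [valueFreq_eq_zero hx _ (by simp [mem_fiberBefore]),
        valueFreq_eq_zero hx _ (by simp [mem_fiberBefore])]
      simpa using ht

end Typical

/-! ## The algorithms -/

theorem QueryTree.result_eq_of_le_one {n : ℕ} (hn : n ≤ 1) (T : QueryTree n)
    (O : Fin n → Fin n → Bool) (P : Setoid (Fin n)) : T.result O = P := by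
  have : Subsingleton (Fin n) := Fin.subsingleton_iff_le_one.mpr hn
  exact Setoid.ext fun u v => by
    rw [Subsingleton.elim u v]
    exact ⟨fun _ => P.refl v, fun _ => Setoid.refl' _ v⟩

/-- The Monte Carlo algorithm: clusters are proposed by `matchingRep` and not verified. -/
noncomputable def trustingAlgorithm (M : ℕ → ℕ) (t a p : ℝ) : ClusterAlgorithm := fun n W =>
  if n ≤ 1 then .output ⊥
  else .trusting (matchingRep (M n) t a p W) (M n) (List.finRange n) id

/-- The Las Vegas algorithm that verifies the hints `H`. -/
noncomputable def guidedAlgorithm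
    (H : ∀ n, (VertexPair n → ℝ) → Fin n → (Fin n → Fin n) → List (Fin n)) : ClusterAlgorithm :=
  fun n W => if n ≤ 1 then .output ⊥ else .guided (H n W) (List.finRange n) id

section Guided

variable {H : ∀ n, (VertexPair n → ℝ) → Fin n → (Fin n → Fin n) → List (Fin n)}

theorem isLasVegas_guidedAlgorithm (hH : ∀ n W v r, ∀ c ∈ H n W v r, c ∈ repsBefore v r) :
    (guidedAlgorithm H).IsLasVegas := by
  intro n W P
  by_cases hn : n ≤ 1
  · exact QueryTree.result_eq_of_le_one hn _ _ _
  · rw [guidedAlgorithm, if_neg hn, ← QueryTree.repsWith_finRange (P := P)]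
    exact (QueryTree.guided_spec (hH n W) P (QueryTree.isTail_finRange n)).1

open Classical in
theorem cost_guidedAlgorithm_le (hH : ∀ n W v r, ∀ c ∈ H n W v r, c ∈ repsBefore v r) {n : ℕ}
    {S : Finset ℝ} (P : Setoid (Fin n)) (W : VertexPair n → S) {m : ℕ}
    (hlen : ∀ v, (H n (fun e => (W e : ℝ)) v (repsAt P v)).length ≤ m) :
    (guidedAlgorithm H).cost P W ≤ n * m +
      (Finset.univ.filter fun v => ¬ ∃ c ∈ H n (fun e => (W e : ℝ)) v (repsAt P v), P v c).card
        * numClusters P := by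
  by_cases hn : n ≤ 1
  · simp [guidedAlgorithm, ClusterAlgorithm.cost, hn, QueryTree.cost]
  · rw [ClusterAlgorithm.cost, guidedAlgorithm, if_neg hn,
      ← QueryTree.repsWith_finRange (P := P)]
    refine (QueryTree.guided_spec (hH n _) P (QueryTree.isTail_finRange n)).2.trans ?_
    rw [← Fin.sum_univ_def, Finset.sum_add_distrib]
    refine Nat.add_le_add ?_ (le_of_eq ?_)
    · simpa using Finset.sum_le_card_nsmul Finset.univ _ m fun v _ => hlen v
    · rw [Finset.card_filter, Finset.sum_mul]
      refine Finset.sum_congr rfl fun v _ => ?_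
      split_ifs <;> simp

/-- Expected cost of a verified algorithm whose hints are right, for side information in `G`, at the
vertices with at least `m` earlier vertices in their cluster. -/
theorem expectedCost_guidedAlgorithm_le
    (hH : ∀ n W v r, ∀ c ∈ H n W v r, c ∈ repsBefore v r) {n : ℕ}
    {S : Finset ℝ} {fp fm : PMF S} (P : Setoid (Fin n)) {m b : ℕ}
    (hlen : ∀ W v r, (H n W v r).length ≤ b) (G : Set (VertexPair n → S))
    (hG : ∀ W ∈ G, ∀ v, m ≤ (earlierIn P v v).card →
      ∃ c ∈ H n (fun e => (W e : ℝ)) v (repsAt P v), P v c) :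
    (guidedAlgorithm H).expectedCost fp fm P ≤
      n * b + m * (numClusters P : ℝ) ^ 2 + (n : ℝ) ^ 2 * (sideInfoLaw fp fm P).real Gᶜ := by
  classical
  have hbound : ∀ W, ((guidedAlgorithm H).cost P W : ℝ) ≤
      (n * b + m * (numClusters P : ℝ) ^ 2) + (Gᶜ).indicator (fun _ => (n : ℝ) ^ 2) W := by
    intro W
    have h1 := cost_guidedAlgorithm_le hH P W (m := b) fun v => hlen _ v _
    set F := Finset.univ.filter fun v =>
      ¬ ∃ c ∈ H n (fun e => (W e : ℝ)) v (repsAt P v), P v c with hF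
    have h1' : ((guidedAlgorithm H).cost P W : ℝ) ≤ n * b + F.card * numClusters P := by
      exact_mod_cast h1
    by_cases hW : W ∈ G
    · rw [Set.indicator_of_notMem (by simpa using hW)]
      have h2 : F.card ≤ m * numClusters P := by
        refine (Finset.card_le_card ?_).trans (card_filter_earlierIn_lt_le P m)
        intro v hv
        simp only [hF, Finset.mem_filter, Finset.mem_univ, true_and] at hv ⊢
        by_contra! hlt
        exact hv (hG W hW v hlt)
      have h2' : (F.card : ℝ) ≤ m * numClusters P := by exact_mod_cast h2
      nlinarith [(Nat.cast_nonneg (numClusters P) : (0 : ℝ) ≤ numClusters P)]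
    -- Off `G`, each of at most `n` vertices may fall back on at most `k ≤ n` representatives.
    · rw [Set.indicator_of_mem (by simpa using hW)]
      have h2 : (F.card : ℝ) ≤ n := by
        exact_mod_cast (Finset.card_le_univ F).trans_eq (Fintype.card_fin n)
      have h3 : (numClusters P : ℝ) ≤ n := by exact_mod_cast numClusters_le P
      have h4 : (F.card : ℝ) * numClusters P ≤ n * n :=
        mul_le_mul h2 h3 (Nat.cast_nonneg _) (Nat.cast_nonneg _)
      have h5 : (0 : ℝ) ≤ m * (numClusters P : ℝ) ^ 2 := by positivity
      nlinarith
  calc (guidedAlgorithm H).expectedCost fp fm P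
      ≤ ∫ W, (n * b + m * (numClusters P : ℝ) ^ 2) + (Gᶜ).indicator (fun _ => (n : ℝ) ^ 2) W
          ∂(sideInfoLaw fp fm P) :=
        integral_mono Integrable.of_finite Integrable.of_finite hbound
    _ = _ := by
        rw [integral_add (integrable_const _) Integrable.of_finite,
          integral_indicator_const _ (Set.toFinite _).measurableSet]
        simp [mul_comm]

end Guided

/-! ## Choice of the sample size -/

/-- The number of vertices of a cluster that makes the frequencies reliable on `n` vertices. -/
noncomputable def sampleSize (ε Δ : ℝ) (n : ℕ) : ℕ := ⌈48 * Real.log n / (ε ^ 2 * Δ)⌉₊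

section SampleSize

variable {ε Δ : ℝ} {n : ℕ}

theorem one_le_sampleSize (hε : 0 < ε) (hΔ : 0 < Δ) (hn : 2 ≤ n) : 1 ≤ sampleSize ε Δ n := by
  have : 0 < Real.log n := Real.log_pos (by exact_mod_cast hn)
  exact Nat.one_le_ceil_iff.mpr (by positivity)

theorem half_le_log (hn : 2 ≤ n) : 1 / 2 ≤ Real.log n := by
  have h1 : Real.log 2 ≤ Real.log n := Real.log_le_log (by norm_num) (by exact_mod_cast hn)
  have := Real.log_two_gt_d9
  linarith

/-- The `+ 1` from rounding up is absorbed: `4 log n ≥ 2 ≥ ε² Δ` turns the constant 48 into 52. -/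
theorem sampleSize_le (hε : 0 < ε) (hΔ : 0 < Δ) (h2 : ε ^ 2 * Δ ≤ 2) (hn : 2 ≤ n) :
    (sampleSize ε Δ n : ℝ) ≤ 52 / ε ^ 2 * (Real.log n / Δ) := by
  have hl := half_le_log hn
  have hpos : 0 < ε ^ 2 * Δ := by positivity
  have h1 : (sampleSize ε Δ n : ℝ) ≤ 48 * Real.log n / (ε ^ 2 * Δ) + 1 :=
    (Nat.ceil_lt_add_one (by positivity)).le
  have h3 : 1 ≤ 4 * Real.log n / (ε ^ 2 * Δ) := by
    rw [le_div_iff₀ hpos]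
    linarith
  calc _ ≤ 48 * Real.log n / (ε ^ 2 * Δ) + 4 * Real.log n / (ε ^ 2 * Δ) := by linarith
    _ = _ := by field_simp; ring

/-- The constant 48 is chosen so that `2 * 48 / 32 = 3`. The exponential is then at most `n⁻³`,
which beats the union bound over `n²` pairs. -/
theorem sq_mul_exp_sampleSize_le (hε : 0 < ε) (hΔ : 0 < Δ) (hn : 2 ≤ n) {t : ℝ}
    (ht : ε ^ 2 * Δ / 32 ≤ t ^ 2) :
    (n : ℝ) ^ 2 * (2 * Real.exp (-2 * sampleSize ε Δ n * t ^ 2)) ≤ 2 / n := by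
  have hn0 : (0 : ℝ) < n := by exact_mod_cast (by omega : 0 < n)
  have hpos : 0 < ε ^ 2 * Δ := by positivity
  have hM : 48 * Real.log n / (ε ^ 2 * Δ) ≤ sampleSize ε Δ n := Nat.le_ceil _
  have h1 : 3 * Real.log n ≤ 2 * sampleSize ε Δ n * t ^ 2 := by
    calc 3 * Real.log n = 2 * (48 * Real.log n / (ε ^ 2 * Δ)) * (ε ^ 2 * Δ / 32) := by
          field_simp; ring
      _ ≤ 2 * sampleSize ε Δ n * t ^ 2 := by gcongr
  have h2 : Real.exp (-2 * sampleSize ε Δ n * t ^ 2) ≤ 1 / (n : ℝ) ^ 3 := by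
    calc _ ≤ Real.exp (-(3 * Real.log n)) := Real.exp_le_exp.mpr (by linarith)
      _ = 1 / (n : ℝ) ^ 3 := by
        rw [Real.exp_neg, ← Real.log_rpow hn0, Real.exp_log (by positivity), one_div]
        norm_cast
  calc _ ≤ (n : ℝ) ^ 2 * (2 * (1 / (n : ℝ) ^ 3)) := by gcongr
    _ = 2 / n := by field_simp

end SampleSize

theorem expectedCost_guidedAlgorithm_of_le_one
    {H : ∀ n, (VertexPair n → ℝ) → Fin n → (Fin n → Fin n) → List (Fin n)} {n : ℕ} (hn : n ≤ 1)
    {S : Finset ℝ} (fp fm : PMF S) (P : Setoid (Fin n)) :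
    (guidedAlgorithm H).expectedCost fp fm P = 0 := by
  simp [ClusterAlgorithm.expectedCost, ClusterAlgorithm.cost, guidedAlgorithm, hn, QueryTree.cost]

/-- Lets a search over dyadic scales replace knowledge of the sample size, at the price of a factor
two. -/
theorem exists_pow_two_mem_Icc {M : ℕ} (hM : 1 ≤ M) : ∃ j, M ≤ 2 ^ j ∧ 2 ^ j ≤ 2 * M := by
  refine ⟨Nat.clog 2 M, Nat.le_pow_clog one_lt_two M, ?_⟩
  rcases hM.eq_or_lt with rfl | hM
  · simp
  · have h1 := Nat.pow_pred_clog_lt_self one_lt_two hM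
    have h2 : 0 < Nat.clog 2 M := Nat.clog_pos one_lt_two hM
    obtain ⟨i, hi⟩ := Nat.exists_eq_succ_of_ne_zero h2.ne'
    rw [hi] at h1 ⊢
    rw [Nat.pred_succ] at h1
    rw [pow_succ]
    omega

theorem natLog_two_add_one_le {n : ℕ} (hn : 2 ≤ n) :
    ((Nat.log 2 n + 1 : ℕ) : ℝ) ≤ 4 * Real.log n := by
  have h0 := half_le_log hn
  have h1 : (Nat.log 2 n : ℝ) * Real.log 2 ≤ Real.log n := by
    rw [← Real.log_pow]
    refine Real.log_le_log (by positivity) ?_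
    exact_mod_cast Nat.pow_log_le_self 2 (by omega)
  have h2 := Real.log_two_gt_d9
  have h3 : (0 : ℝ) ≤ Nat.log 2 n := Nat.cast_nonneg _
  push_cast
  nlinarith

/-! ### The three query bounds -/

namespace AdmissiblePair

variable {ε : ℝ} {S : Finset ℝ} {fp fm : PMF S}

/-- A quarter of the gap serves both tests: matching needs a gap of `2 * t`, isolation one of `4 *
t`. The square of the quarter turns `ε² Δ / 2` into `ε² Δ / 32`. -/
theorem exists_margin (h : AdmissiblePair ε fp fm) (hε : 0 < ε) :
    ∃ (a : S) (t : ℝ), 0 ≤ t ∧ 4 * t = |(fp a).toReal - (fm a).toReal| ∧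
      ε ^ 2 * symmDivergence fp fm / 32 ≤ t ^ 2 := by
  obtain ⟨a, ha⟩ := h.exists_sq_le hε
  refine ⟨a, |(fp a).toReal - (fm a).toReal| / 4, by positivity, by ring, ?_⟩
  rw [div_pow, sq_abs]
  linarith

theorem monteCarlo (h : AdmissiblePair ε fp fm) (hε : 0 < ε) :
    ∃ A : ClusterAlgorithm, ∀ (n : ℕ) (P : Setoid (Fin n)),
      1 - 2 / (n : ℝ) ≤ A.successProb fp fm P ∧
      ∀ W : VertexPair n → S, (A.cost P W : ℝ) ≤
        104 / ε ^ 2 * ((numClusters P : ℝ) ^ 2 * Real.log n / symmDivergence fp fm) := by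
  obtain ⟨a, t, ht, ha, ht2⟩ := h.exists_margin hε
  have hΔ := h.symmDivergence_pos
  refine ⟨trustingAlgorithm (sampleSize ε (symmDivergence fp fm)) t a (fp a).toReal,
    fun n P => ?_⟩
  -- For `n ≤ 1` the logarithm, and with it the sample size, is zero. For `n = 0` division by zero
  -- makes the required probability equal to one.
  by_cases hn : n ≤ 1
  · constructor
    · have : {W | (trustingAlgorithm (sampleSize ε (symmDivergence fp fm)) t a
          (fp a).toReal).result P W = P} = (Set.univ : Set (VertexPair n → S)) :=
        Set.eq_univ_of_forall fun W => QueryTree.result_eq_of_le_one hn _ _ _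
      rw [ClusterAlgorithm.successProb, this, probReal_univ]
      have : (0 : ℝ) ≤ 2 / n := by positivity
      linarith
    · intro W
      have : 0 ≤ Real.log n := Real.log_natCast_nonneg n
      simp only [ClusterAlgorithm.cost, trustingAlgorithm, hn, if_true, QueryTree.cost]
      push_cast
      positivity
  · have hn2 : 2 ≤ n := by omega
    set M := sampleSize ε (symmDivergence fp fm) n with hMdef
    have hM : 1 ≤ M := one_le_sampleSize hε hΔ hn2
    constructor
    · have hsub : typicalAt fp fm P M t a ⊆ {W | (trustingAlgorithm
          (sampleSize ε (symmDivergence fp fm)) t a (fp a).toReal).result P W = P} := by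
        intro W hW
        rw [Set.mem_ofPred_eq, ClusterAlgorithm.result, trustingAlgorithm, if_neg hn,
          ← QueryTree.repsWith_finRange (P := P)]
        exact QueryTree.result_trusting
          (fun v c hc => matchingRep_eq_firstIn hW (by linarith) hc)
          (fun v hv => matchingRep_eq_none hM hW hv) (QueryTree.isTail_finRange n)
      have h1 := (sideInfoLaw_real_compl_typicalAt_le fp fm P hM ht a).trans
        (sq_mul_exp_sampleSize_le hε hΔ hn2 ht2)
      rw [probReal_compl_eq_one_sub (Set.toFinite _).measurableSet] at h1
      have h2 := measureReal_mono (μ := sideInfoLaw fp fm P) hsub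
      rw [ClusterAlgorithm.successProb]
      linarith
    · intro W
      have h1 : (trustingAlgorithm (sampleSize ε (symmDivergence fp fm)) t a
          (fp a).toReal).cost P W ≤ numClusters P * (M * numClusters P + 1) := by
        rw [ClusterAlgorithm.cost, trustingAlgorithm, if_neg hn]
        exact QueryTree.cost_trusting_finRange_le
          (fun v r c hc => (matchingRep_eq_some hc).1) hM P
      have h2 : numClusters P * (M * numClusters P + 1) ≤ 2 * numClusters P ^ 2 * M := by
        have : numClusters P ≤ numClusters P ^ 2 * M :=
          (Nat.le_self_pow two_ne_zero _).trans (Nat.le_mul_of_pos_right _ hM)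
        calc _ = numClusters P ^ 2 * M + numClusters P := by ring
          _ ≤ numClusters P ^ 2 * M + numClusters P ^ 2 * M := by omega
          _ = _ := by ring
      have h3 := sampleSize_le hε hΔ (h.sq_mul_symmDivergence_le_two hε) hn2
      calc _ ≤ 2 * (numClusters P : ℝ) ^ 2 * M := by exact_mod_cast h1.trans h2
        _ ≤ 2 * (numClusters P : ℝ) ^ 2 *
            (52 / ε ^ 2 * (Real.log n / symmDivergence fp fm)) := by gcongr
        _ = _ := by ring

theorem lasVegas (h : AdmissiblePair ε fp fm) (hε : 0 < ε) :
    ∃ A : ClusterAlgorithm, A.IsLasVegas ∧ ∀ (n : ℕ) (P : Setoid (Fin n)),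
      A.expectedCost fp fm P ≤
        (3 + 52 / ε ^ 2) *
          ((n : ℝ) + (numClusters P : ℝ) ^ 2 * Real.log n / symmDivergence fp fm) := by
  obtain ⟨a, t, ht, ha, ht2⟩ := h.exists_margin hε
  have hΔ := h.symmDivergence_pos
  have hH : ∀ n W v r, ∀ c ∈ (matchingRep (n := n)
      (sampleSize ε (symmDivergence fp fm) n) t a (fp a).toReal W v r).toList,
      c ∈ repsBefore v r :=
    fun n W v r c hc => (matchingRep_eq_some (Option.mem_toList.mp hc)).1
  refine ⟨guidedAlgorithm fun n W v r => (matchingRep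
    (sampleSize ε (symmDivergence fp fm) n) t a (fp a).toReal W v r).toList,
    isLasVegas_guidedAlgorithm hH, fun n P => ?_⟩
  have hlog : 0 ≤ Real.log n := Real.log_natCast_nonneg n
  set L := (numClusters P : ℝ) ^ 2 * Real.log n / symmDivergence fp fm with hL
  have hL0 : 0 ≤ L := by positivity
  by_cases hn : n ≤ 1
  · rw [expectedCost_guidedAlgorithm_of_le_one hn]
    positivity
  have hn2 : 2 ≤ n := by omega
  have hn0 : (0 : ℝ) < n := by exact_mod_cast (by omega : 0 < n)
  set M := sampleSize ε (symmDivergence fp fm) n with hMdef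
  have hM : 1 ≤ M := one_le_sampleSize hε hΔ hn2
  have h1 := expectedCost_guidedAlgorithm_le hH (fp := fp) (fm := fm) P (m := M) (b := 1)
    (fun W v r => Option.length_toList_le) (typicalAt fp fm P M t a) (by
      intro W hW v hv
      cases hc : matchingRep M t a (fp a).toReal (fun e => (W e : ℝ)) v (repsAt P v) with
      | none => exact absurd (matchingRep_eq_none hM hW hc) (by omega)
      | some c =>
        refine ⟨c, by simp, ?_⟩
        rw [matchingRep_eq_firstIn hW (by linarith) hc]
        exact rel_firstIn P v)
  have h2 := (sideInfoLaw_real_compl_typicalAt_le fp fm P hM ht a).trans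
        (sq_mul_exp_sampleSize_le hε hΔ hn2 ht2)
  have h3 := sampleSize_le hε hΔ (h.sq_mul_symmDivergence_le_two hε) hn2
  refine h1.trans ?_
  calc _ ≤ (n : ℝ) * (1 : ℕ) + (52 / ε ^ 2 * (Real.log n / symmDivergence fp fm)) *
        (numClusters P : ℝ) ^ 2 + (n : ℝ) ^ 2 * (2 / n) := by gcongr
    _ = 3 * n + 52 / ε ^ 2 * L := by rw [hL]; field_simp; push_cast; ring
    _ ≤ 3 * n + 52 / ε ^ 2 * L + (3 * L + 52 / ε ^ 2 * n) := by
        have : 0 ≤ 3 * L + 52 / ε ^ 2 * n := by positivity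
        linarith
    _ = _ := by ring

theorem expectedCost_multiscaleHints_le (h : AdmissiblePair ε fp fm) (hε : 0 < ε) (n : ℕ)
    (P : Setoid (Fin n)) :
    (guidedAlgorithm fun _ => multiscaleHints).expectedCost fp fm P ≤
      (12 + 4 / ε + 104 / ε ^ 2) * ((n : ℝ) * Real.log n +
        (numClusters P : ℝ) ^ 2 * Real.log n / symmDivergence fp fm) := by
  obtain ⟨a, t, ht, ha, ht2⟩ := h.exists_margin hε
  have hΔ := h.symmDivergence_pos
  have hlog : 0 ≤ Real.log n := Real.log_natCast_nonneg n
  set L := (numClusters P : ℝ) ^ 2 * Real.log n / symmDivergence fp fm with hL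
  have hL0 : 0 ≤ L := by positivity
  by_cases hn : n ≤ 1
  · rw [expectedCost_guidedAlgorithm_of_le_one hn]
    positivity
  have hn2 : 2 ≤ n := by omega
  have hn0 : (0 : ℝ) < n := by exact_mod_cast (by omega : 0 < n)
  set M := sampleSize ε (symmDivergence fp fm) n with hMdef
  have hM : 1 ≤ M := one_le_sampleSize hε hΔ hn2
  obtain ⟨j, hj1, hj2⟩ := exists_pow_two_mem_Icc hM
  have h1 := expectedCost_guidedAlgorithm_le (H := fun _ => multiscaleHints)
    (fun n W v r c hc => mem_repsBefore_of_mem_multiscaleHints hc) (fp := fp) (fm := fm) P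
    (m := 2 ^ j) (b := 3 * (Nat.log 2 n + 1))
    (fun W v r => length_multiscaleHints_le W v r) (typical fp fm P M t) (by
      intro W hW v hv
      refine ⟨firstIn P v, List.mem_flatMap.mpr ⟨j, ?_,
        firstIn_mem_hintsOfSize Nat.one_le_two_pow hj1 ht hW ha.le hv⟩, rel_firstIn P v⟩
      -- The scale `2 ^ j` may exceed `n`, but then no vertex has that many predecessors and there
      -- is nothing to show.
      have : 2 ^ j ≤ n := hv.trans ((Finset.card_le_univ _).trans_eq (Fintype.card_fin n))
      exact List.mem_range.mpr (Nat.lt_succ_of_le (Nat.le_log_of_pow_le one_lt_two this)))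
  have hS : (S.card : ℝ) ≤ 1 / ε := by
    rw [le_div_iff₀ hε]
    exact h.card_mul_le
  have h2 : (sideInfoLaw fp fm P).real (typical fp fm P M t)ᶜ ≤ 1 / ε * (2 / n) :=
    (sideInfoLaw_real_compl_typical_le fp fm P hM ht).trans
      (mul_le_mul hS (sq_mul_exp_sampleSize_le hε hΔ hn2 ht2) (by positivity) (by positivity))
  have h3 := sampleSize_le hε hΔ (h.sq_mul_symmDivergence_le_two hε) hn2
  have h4 : ((2 ^ j : ℕ) : ℝ) ≤ 2 * (52 / ε ^ 2 * (Real.log n / symmDivergence fp fm)) := by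
    have : ((2 ^ j : ℕ) : ℝ) ≤ 2 * M := by exact_mod_cast hj2
    linarith
  have h5 : ((3 * (Nat.log 2 n + 1) : ℕ) : ℝ) ≤ 3 * (4 * Real.log n) := by
    rw [Nat.cast_mul]
    exact mul_le_mul_of_nonneg_left (natLog_two_add_one_le hn2) (by norm_num)
  have h6 := half_le_log hn2
  refine h1.trans ?_
  calc _ ≤ (n : ℝ) * (3 * (4 * Real.log n)) +
        2 * (52 / ε ^ 2 * (Real.log n / symmDivergence fp fm)) * (numClusters P : ℝ) ^ 2 +
        (n : ℝ) ^ 2 * (1 / ε * (2 / n)) := by gcongr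
    -- The atypical part `2 n / ε` is written with a factor `1 / 2`, which is at most `log n`.
    _ = 12 * (n * Real.log n) + 104 / ε ^ 2 * L + 4 / ε * (n * (1 / 2)) := by
        rw [hL]; field_simp; ring
    _ ≤ 12 * (n * Real.log n) + 104 / ε ^ 2 * L + 4 / ε * (n * Real.log n) := by gcongr
    _ ≤ 12 * (n * Real.log n) + 104 / ε ^ 2 * L + 4 / ε * (n * Real.log n) +
          ((12 + 4 / ε) * L + 104 / ε ^ 2 * (n * Real.log n)) := by
        have : 0 ≤ (12 + 4 / ε) * L + 104 / ε ^ 2 * (n * Real.log n) := by positivity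
        linarith
    _ = _ := by ring

end AdmissiblePair

theorem mainTheorem2 :
    -- known `fp` and `fm`, unknown number of clusters
    (∀ ε : ℝ, 0 < ε → ∃ C : ℝ, 0 < C ∧
      ∀ (S : Finset ℝ) (fp fm : PMF S), AdmissiblePair ε fp fm →
        -- Monte Carlo
        (∃ A : ClusterAlgorithm, ∀ (n : ℕ) (P : Setoid (Fin n)),
          1 - 2 / (n : ℝ) ≤ A.successProb fp fm P ∧
          ∀ W : VertexPair n → S,
            (A.cost P W : ℝ) ≤
              C * ((numClusters P : ℝ) ^ 2 * Real.log n / symmDivergence fp fm)) ∧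
        -- Las Vegas
        (∃ A : ClusterAlgorithm, A.IsLasVegas ∧ ∀ (n : ℕ) (P : Setoid (Fin n)),
          A.expectedCost fp fm P ≤
            C * ((n : ℝ) + (numClusters P : ℝ) ^ 2 * Real.log n / symmDivergence fp fm))) ∧
    -- Las Vegas with unknown `fp`, `fm` (and their points and `ε`) and unknown number of clusters
    (∃ A : ClusterAlgorithm, A.IsLasVegas ∧
      ∀ ε : ℝ, 0 < ε → ∃ C : ℝ, 0 < C ∧
        ∀ (S : Finset ℝ) (fp fm : PMF S), AdmissiblePair ε fp fm →
          ∀ (n : ℕ) (P : Setoid (Fin n)),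
            A.expectedCost fp fm P ≤
              C * ((n : ℝ) * Real.log n +
                (numClusters P : ℝ) ^ 2 * Real.log n / symmDivergence fp fm)) := by
  refine ⟨fun ε hε => ?_, guidedAlgorithm fun _ => multiscaleHints,
    isLasVegas_guidedAlgorithm fun n W v r c hc => mem_repsBefore_of_mem_multiscaleHints hc,
    fun ε hε => ⟨12 + 4 / ε + 104 / ε ^ 2, by positivity,
      fun S fp fm h n P => h.expectedCost_multiscaleHints_le hε n P⟩⟩
  have h104 : 104 / ε ^ 2 ≤ 3 + 104 / ε ^ 2 := by linarith
  have h52 : 3 + 52 / ε ^ 2 ≤ 3 + 104 / ε ^ 2 := by gcongr; norm_num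
  refine ⟨3 + 104 / ε ^ 2, by positivity, fun S fp fm h => ⟨?_, ?_⟩⟩
  · obtain ⟨A, hA⟩ := h.monteCarlo hε
    refine ⟨A, fun n P => ⟨(hA n P).1, fun W => ((hA n P).2 W).trans ?_⟩⟩
    have := h.symmDivergence_pos
    have := Real.log_natCast_nonneg n
    exact mul_le_mul_of_nonneg_right h104 (by positivity)
  · obtain ⟨A, hLV, hA⟩ := h.lasVegas hε
    refine ⟨A, hLV, fun n P => (hA n P).trans ?_⟩
    have := h.symmDivergence_pos
    have := Real.log_natCast_nonneg n
    exact mul_le_mul_of_nonneg_right h52 (by positivity)
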